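/- Let $\mathcal T$ be the Thue--Morse set, i.e. the set of natural numbers whose binary expansion contains an even number of digits $1$, and write $m\mathcal T+r=\{mt+r : t\in\mathcal T\}$. For $p\ge 1$, a deterministic finite automaton over the digits $0,\dots,2^p-1$, with a total transition function, recognizes a set $Y\subseteq\mathbb N$ in base $2^p$ if it accepts exactly those words (read most significant digit first, leading zeros allowed) whose value in base $2^p$ belongs to $Y$. There is an algorithm which, given $p\ge 1$ and a complete DFA $\mathcal A$ that recognizes a set $Y\subseteq\mathbb N$ in base $2^p$, decides whether $Y=m\mathcal T+r$ for some integers $m\ge 1$ and $0\le r\le m-1$. For each fixed $p$ it runs in time $O(N^2)$, where $N$ is the number of states of $\mathcal A$ (the implied constant depends only on $p$). Here time is the number of elementary steps of a random access machine on which every arithmetic operation on words (addition, truncated subtraction, multiplication, integer division), every comparison of two words and every memory access costs one step, and all numbers written during the computation are $O(N^2)$, again with a constant depending only on $p$, so that words have $O(\log N)$ bits. The input is the transition table of $\mathcal A$, its initial state and its set of accepting states, together with $N$ and $p$. -/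

import Mathlib

/-! ### Thue-Morse set, expansions, recognition -/

/-- The Thue-Morse set: the natural numbers whose binary expansion has an even number of `1`s. -/
def thueMorseSet : Set ℕ := {n | Even ((Nat.digits 2 n).count 1)}

/-- The set `m T + r`, where `T` is the Thue-Morse set. -/
def thueMorseAffine (m r : ℕ) : Set ℕ := (fun t => m * t + r) '' thueMorseSet

/-- The value in base `b` of a word over the digits `0, …, b - 1`, most significant digit first. -/
def wordVal {b : ℕ} (w : List (Fin b)) : ℕ := Nat.ofDigits b (w.map Fin.val).reverse

/-- The automaton `A` recognizes the set `Y` in base `b`: it accepts exactly the words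
(with any number of leading zeros) whose value in base `b` lies in `Y`. -/
def RecognizesSet {b : ℕ} {σ : Type*} (A : DFA (Fin b) σ) (Y : Set ℕ) : Prop :=
  A.accepts = {w : List (Fin b) | wordVal w ∈ Y}

/-! ### Random access machines with unit cost and bounded words -/

namespace RAM

/-- The contents of the machine: registers and random-access arrays, both holding natural numbers.
A program names its registers and arrays explicitly, hence uses finitely many of them. -/
structure Store where
  reg : ℕ → ℕ
  arr : ℕ → ℕ → ℕ

/-- Replace the content of register `x` by `v`. -/
def Store.setReg (s : Store) (x v : ℕ) : Store :=
  { s with reg := Function.update s.reg x v }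

/-- Replace the content of cell `i` of array `a` by `v`. -/
def Store.setArr (s : Store) (a i v : ℕ) : Store :=
  { s with arr := Function.update s.arr a (Function.update (s.arr a) i v) }

/-- Arithmetic operations on words. -/
inductive Op
  | add | sub | mul | div

/-- Subtraction is truncated at `0`; division is rounded down, and division by `0` gives `0`. -/
def Op.eval : Op → ℕ → ℕ → ℕ
  | .add, m, n => m + n
  | .sub, m, n => m - n
  | .mul, m, n => m * n
  | .div, m, n => m / n

/-- Tests: comparisons of two registers. -/
inductive Test
  | lt (x y : ℕ)
  | eq (x y : ℕ)

def Test.holds : Test → Store → Prop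
  | .lt x y, s => s.reg x < s.reg y
  | .eq x y, s => s.reg x = s.reg y

/-- Programs. -/
inductive Program
  /-- do nothing -/
  | skip
  /-- `x := n`, where `n` is a constant written in the program -/
  | const (x n : ℕ)
  /-- `x := y o z` -/
  | op (o : Op) (x y z : ℕ)
  /-- `x := a[y]` (array `a`, index in register `y`) -/
  | load (x a y : ℕ)
  /-- `a[x] := y` (array `a`, index in register `x`) -/
  | store (a x y : ℕ)
  | seq (P Q : Program)
  | ite (c : Test) (P Q : Program)
  | while (c : Test) (P : Program)

/-- `Exec W P s t s'`: on a machine whose words hold the numbers `0, …, W`, the program `P`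
started in `s` halts after exactly `t` elementary steps in `s'`. Every assignment and every
test is one step. An execution that would write a number exceeding `W` is not an execution. -/
inductive Exec (W : ℕ) : Program → Store → ℕ → Store → Prop
  | skip (s : Store) : Exec W .skip s 1 s
  | const (s : Store) (x n : ℕ) (h : n ≤ W) : Exec W (.const x n) s 1 (s.setReg x n)
  | op (s : Store) (o : Op) (x y z : ℕ) (h : o.eval (s.reg y) (s.reg z) ≤ W) :
      Exec W (.op o x y z) s 1 (s.setReg x (o.eval (s.reg y) (s.reg z)))
  | load (s : Store) (x a y : ℕ) (h : s.arr a (s.reg y) ≤ W) :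
      Exec W (.load x a y) s 1 (s.setReg x (s.arr a (s.reg y)))
  | store (s : Store) (a x y : ℕ) (h : s.reg y ≤ W) :
      Exec W (.store a x y) s 1 (s.setArr a (s.reg x) (s.reg y))
  | seq {P Q : Program} {s s₁ s₂ : Store} {t₁ t₂ : ℕ}
      (h₁ : Exec W P s t₁ s₁) (h₂ : Exec W Q s₁ t₂ s₂) : Exec W (.seq P Q) s (t₁ + t₂) s₂
  | iteTrue {c : Test} {P Q : Program} {s s₁ : Store} {t : ℕ}
      (hc : c.holds s) (h : Exec W P s t s₁) : Exec W (.ite c P Q) s (1 + t) s₁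
  | iteFalse {c : Test} {P Q : Program} {s s₁ : Store} {t : ℕ}
      (hc : ¬ c.holds s) (h : Exec W Q s t s₁) : Exec W (.ite c P Q) s (1 + t) s₁
  | whileFalse {c : Test} {P : Program} {s : Store}
      (hc : ¬ c.holds s) : Exec W (.while c P) s 1 s
  | whileTrue {c : Test} {P : Program} {s s₁ s₂ : Store} {t₁ t₂ : ℕ}
      (hc : c.holds s) (h₁ : Exec W P s t₁ s₁) (h₂ : Exec W (.while c P) s₁ t₂ s₂) :
      Exec W (.while c P) s (1 + t₁ + t₂) s₂

/-- Executions are deterministic: the result and the number of steps are determined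
by the program and the initial contents. -/
theorem Exec.deterministic {W : ℕ} {P : Program} {s s₁ s₂ : Store} {t₁ t₂ : ℕ}
    (h₁ : Exec W P s t₁ s₁) (h₂ : Exec W P s t₂ s₂) : t₁ = t₂ ∧ s₁ = s₂ := by
  induction h₁ generalizing t₂ s₂ with
  | seq _ _ ih₁ ih₂ =>
    cases h₂ with
    | seq a b =>
      obtain ⟨rfl, rfl⟩ := ih₁ a
      obtain ⟨rfl, rfl⟩ := ih₂ b
      exact ⟨rfl, rfl⟩
  | iteTrue hc _ ih =>
    cases h₂ with
    | iteTrue _ a => obtain ⟨rfl, rfl⟩ := ih a; exact ⟨rfl, rfl⟩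
    | iteFalse hn _ => exact absurd hc hn
  | iteFalse hc _ ih =>
    cases h₂ with
    | iteTrue hn _ => exact absurd hn hc
    | iteFalse _ a => obtain ⟨rfl, rfl⟩ := ih a; exact ⟨rfl, rfl⟩
  | whileFalse hc =>
    cases h₂ with
    | whileFalse _ => exact ⟨rfl, rfl⟩
    | whileTrue hn _ _ => exact absurd hn hc
  | whileTrue hc _ _ ih₁ ih₂ =>
    cases h₂ with
    | whileFalse hn => exact absurd hc hn
    | whileTrue _ a b =>
      obtain ⟨rfl, rfl⟩ := ih₁ a
      obtain ⟨rfl, rfl⟩ := ih₂ b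
      exact ⟨rfl, rfl⟩
  | _ => cases h₂; exact ⟨rfl, rfl⟩

open Classical in
/-- The initial contents of the machine for the input `A`, a DFA with states `0, …, N - 1` over the
digits `0, …, 2 ^ p - 1`. Registers `0, 1, 2` hold `N`, `p` and the initial state. Array `0` holds
the transition table row by row (the cell `i * 2 ^ p + d` holds the state reached from `i` by
reading `d`), and array `1` marks the accepting states by `1`. Everything else is `0`. -/
noncomputable def inputStore (p N : ℕ) (A : DFA (Fin (2 ^ p)) (Fin N)) : Store where
  reg := fun x =>
    if x = 0 then N else if x = 1 then p else if x = 2 then (A.start : ℕ) else 0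
  arr := fun a j =>
    if a = 0 then
      if h : j < N * 2 ^ p then
        (A.step ⟨j / 2 ^ p, Nat.div_lt_of_lt_mul (by rwa [Nat.mul_comm] at h)⟩
          ⟨j % 2 ^ p, Nat.mod_lt _ (by positivity)⟩ : ℕ)
      else 0
    else if a = 1 then
      if h : j < N then (if (⟨j, h⟩ : Fin N) ∈ A.accept then 1 else 0) else 0
    else 0

end RAM

/-!
Let `b = 2 ^ p`. Deleting the last digit from the elements of `m𝒯 + r` that end like `r` leaves
`m'𝒯 + r'` for some `m'`, and `m' = m / b` if `b` divides `m`. If `b` does not divide `m`, then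
`r` and `r + 3 * m`, which both lie in `m𝒯 + r`, end in different digits because `b` is coprime
to `3`. So a last digit is common to all elements exactly as long as `b` divides `m`. After `N`
deletions `b` does not divide `m`, since an automaton with `N` states cannot remember more than
`N` digits. Now the odd part of `m` is at most `N`: words whose values differ modulo it lead to
different states. Hence `m ≤ b * N`.

As `1` and `2` are not in `𝒯` but `0` and `3` are, the two least elements of `m𝒯 + r` are `r` and
`r + 3 * m < 4 * b * N`. The states reached by words of value below `4 * b * N` therefore determine
the only possible pair `(m, r)`. It is verified by exploring the reachable combinations of a state
of the automaton, the remainder of the value read modulo `m`, and the Thue–Morse parity of the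
quotient. There are at most `2 * N * m = O(N²)` of them.
-/

/-! ### Thue–Morse parity -/

/-- The `n`-th term of the Thue–Morse sequence: the parity of the number of binary digits `1`
of `n`. -/
def thueMorseBit (n : ℕ) : ℕ := (Nat.digits 2 n).count 1 % 2

theorem mem_thueMorseSet_iff (n : ℕ) : n ∈ thueMorseSet ↔ thueMorseBit n = 0 :=
  Nat.even_iff

theorem thueMorseBit_lt_two (n : ℕ) : thueMorseBit n < 2 := Nat.mod_lt _ (by norm_num)

theorem thueMorseBit_zero : thueMorseBit 0 = 0 := by simp [thueMorseBit]

theorem thueMorseBit_three : thueMorseBit 3 = 0 := by simp [thueMorseBit]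

theorem thueMorseBit_eq_half (n : ℕ) : thueMorseBit n = (thueMorseBit (n / 2) + n) % 2 := by
  rcases Nat.eq_zero_or_pos n with rfl | hn
  · simp [thueMorseBit]
  · unfold thueMorseBit
    rw [Nat.digits_def' (by norm_num) hn, List.count_cons]
    rcases Nat.mod_two_eq_zero_or_one n with h | h <;> simp [h] <;> omega

theorem thueMorseBit_two_mul (n : ℕ) : thueMorseBit (2 * n) = thueMorseBit n := by
  have hlt := thueMorseBit_lt_two n
  rw [thueMorseBit_eq_half, Nat.mul_div_cancel_left _ two_pos]
  omega

theorem thueMorseBit_two_mul_add_one (n : ℕ) :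
    thueMorseBit (2 * n + 1) = 1 - thueMorseBit n := by
  have hlt := thueMorseBit_lt_two n
  rw [thueMorseBit_eq_half, show (2 * n + 1) / 2 = n by omega]
  omega

theorem thueMorseBit_mul_two_pow_add (p a c : ℕ) (hc : c < 2 ^ p) :
    thueMorseBit (a * 2 ^ p + c) = (thueMorseBit a + thueMorseBit c) % 2 := by
  induction p generalizing c with
  | zero =>
    obtain rfl : c = 0 := by simpa using hc
    simp [thueMorseBit_zero, Nat.mod_eq_of_lt (thueMorseBit_lt_two a)]
  | succ p ih =>
    rw [pow_succ] at hc ⊢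
    rw [thueMorseBit_eq_half, thueMorseBit_eq_half c,
      show (a * (2 ^ p * 2) + c) / 2 = a * 2 ^ p + c / 2 by rw [← mul_assoc]; omega,
      ih (c / 2) (by omega), ← mul_assoc]
    omega

theorem exists_thueMorseBit_eq_zero (s : ℕ) :
    ∃ t, 2 * s ≤ t ∧ t < 2 * s + 2 ∧ thueMorseBit t = 0 := by
  have hlt := thueMorseBit_lt_two s
  have heven := thueMorseBit_two_mul s
  have hodd := thueMorseBit_two_mul_add_one s
  by_cases h : thueMorseBit s = 0
  · exact ⟨2 * s, by omega⟩
  · exact ⟨2 * s + 1, by omega⟩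

theorem card_thueMorseBit_eq_zero (c : ℕ) :
    ((Finset.range (2 * c)).filter (thueMorseBit · = 0)).card = c := by
  induction c with
  | zero => simp
  | succ c ih =>
    have hlt := thueMorseBit_lt_two c
    rw [show 2 * (c + 1) = 2 * c + 1 + 1 by ring, Finset.range_add_one, Finset.range_add_one,
      Finset.filter_insert, Finset.filter_insert, thueMorseBit_two_mul,
      thueMorseBit_two_mul_add_one]
    by_cases h : thueMorseBit c = 0
    · rw [if_neg (by omega), if_pos h, Finset.card_insert_of_notMem (by simp), ih]
    · rw [if_pos (by omega), if_neg h, Finset.card_insert_of_notMem (by simp), ih]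

/-! ### The sets `m T + r` -/

/-- `Y` is of the form `m T + r` with `0 ≤ r < m`. -/
def IsThueMorseAffine (Y : Set ℕ) : Prop := ∃ m r : ℕ, r < m ∧ Y = thueMorseAffine m r

theorem mul_add_lt_mul {a b q d : ℕ} (hq : q < a) (hd : d < b) : q * b + d < a * b :=
  calc q * b + d < q * b + b := by omega
    _ = (q + 1) * b := by ring
    _ ≤ a * b := Nat.mul_le_mul_right b hq

theorem mul_add_div_of_lt {a b d : ℕ} (hd : d < b) : (a * b + d) / b = a := by
  rw [mul_comm, Nat.mul_add_div (by omega), Nat.div_eq_of_lt hd, add_zero]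

section

variable {m r : ℕ}

theorem mem_thueMorseAffine_iff (h : r < m) (n : ℕ) :
    n ∈ thueMorseAffine m r ↔ n % m = r ∧ thueMorseBit (n / m) = 0 := by
  simp only [thueMorseAffine, Set.mem_image, mem_thueMorseSet_iff, mul_comm m]
  constructor
  · rintro ⟨t, ht, rfl⟩
    rw [mul_add_div_of_lt h, Nat.mul_add_mod', Nat.mod_eq_of_lt h]
    exact ⟨rfl, ht⟩
  · rintro ⟨hmod, hdiv⟩
    exact ⟨n / m, hdiv, by rw [← hmod, Nat.div_add_mod']⟩

theorem mul_add_mem_thueMorseAffine_iff (h : r < m) (t : ℕ) :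
    t * m + r ∈ thueMorseAffine m r ↔ thueMorseBit t = 0 := by
  simp [mem_thueMorseAffine_iff h, mul_add_div_of_lt h, Nat.mod_eq_of_lt h]

theorem self_mem_thueMorseAffine (h : r < m) : r ∈ thueMorseAffine m r := by
  simpa using (mul_add_mem_thueMorseAffine_iff h 0).2 thueMorseBit_zero

theorem add_three_mul_mem_thueMorseAffine (h : r < m) : r + 3 * m ∈ thueMorseAffine m r := by
  rw [add_comm]
  exact (mul_add_mem_thueMorseAffine_iff h 3).2 thueMorseBit_three

/-- `1` and `2` are not in `T`, so `r` and `r + 3 * m` are the two least elements of `m T + r`. -/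
theorem eq_of_mem_thueMorseAffine_of_lt {n : ℕ} (hn : n ∈ thueMorseAffine m r)
    (hlt : n < r + 3 * m) : n = r := by
  obtain ⟨t, ht, rfl⟩ := hn
  have hthree : t < 3 := by
    by_contra hle
    have := Nat.mul_le_mul_left m (not_lt.1 hle)
    simp only at hlt
    omega
  rw [mem_thueMorseSet_iff] at ht
  interval_cases t
  · simp
  · simp [thueMorseBit] at ht
  · simp [thueMorseBit] at ht

theorem mul_add_mem_thueMorseAffine_mul_iff {c d : ℕ} (h : r < m * c) (hd : d < c) (n : ℕ) :
    n * c + d ∈ thueMorseAffine (m * c) r ↔ d = r % c ∧ n ∈ thueMorseAffine m (r / c) := by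
  have hr : r / c < m := Nat.div_lt_of_lt_mul (by rwa [mul_comm])
  have hdiv : (n * c + d) / (m * c) = n / m := by
    rw [mul_comm m, ← Nat.div_div_eq_div_mul, mul_add_div_of_lt hd]
  have hmod : (n * c + d) % (m * c) = n % m * c + d := by
    have hlt : n % m * c + d < m * c :=
      mul_add_lt_mul (Nat.mod_lt _ (Nat.zero_lt_of_lt hr)) hd
    have hsplit : n * c + d = n % m * c + d + m * c * (n / m) := by
      conv_lhs => rw [← Nat.div_add_mod n m]
      ring
    rw [hsplit, Nat.add_mul_mod_self_left, Nat.mod_eq_of_lt hlt]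
  rw [mem_thueMorseAffine_iff h, mem_thueMorseAffine_iff hr, hdiv, hmod, ← and_assoc]
  refine and_congr_left fun _ => ⟨?_, ?_⟩
  · rintro rfl
    rw [Nat.mul_add_mod', Nat.mod_eq_of_lt hd, mul_add_div_of_lt hd]
    exact ⟨rfl, rfl⟩
  · rintro ⟨hlast, hrest⟩
    rw [hrest, hlast, Nat.div_add_mod']

theorem exists_add_mem_thueMorseAffine (h : r < m) (n : ℕ) :
    ∃ x < 4 * m, n + x ∈ thueMorseAffine m r := by
  obtain ⟨t, hle, hlt, ht⟩ := exists_thueMorseBit_eq_zero (n / (2 * m) + 1)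
  have hn := Nat.div_add_mod' n (2 * m)
  have hmod := Nat.mod_lt n (show 0 < 2 * m by omega)
  have hlower : n < t * m :=
    calc n < (n / (2 * m)) * (2 * m) + 2 * m := by omega
      _ = 2 * (n / (2 * m) + 1) * m := by ring
      _ ≤ t * m := Nat.mul_le_mul_right m hle
  have hupper : t * m + m ≤ n + 4 * m :=
    calc t * m + m = (t + 1) * m := by ring
      _ ≤ (2 * (n / (2 * m) + 1) + 2) * m := Nat.mul_le_mul_right m hlt
      _ = (n / (2 * m)) * (2 * m) + 4 * m := by ring
      _ ≤ n + 4 * m := by omega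
  refine ⟨t * m + r - n, by omega, ?_⟩
  rw [Nat.add_sub_cancel' (by omega)]
  exact (mul_add_mem_thueMorseAffine_iff h t).2 ht

open Classical in
theorem card_filter_range_mem_thueMorseAffine (h : r < m) (c : ℕ) :
    ((Finset.range (2 * (m * c))).filter (· ∈ thueMorseAffine m r)).card = c := by
  have hlt (t : ℕ) : m * t + r < 2 * (m * c) ↔ t < 2 * c := by
    rw [show 2 * (m * c) = 2 * c * m by ring, ← Nat.div_lt_iff_lt_mul (by omega), mul_comm m,
      mul_add_div_of_lt h]
  have himage : (Finset.range (2 * (m * c))).filter (· ∈ thueMorseAffine m r) =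
      ((Finset.range (2 * c)).filter (thueMorseBit · = 0)).image (m * · + r) := by
    ext n
    simp only [thueMorseAffine, Finset.mem_filter, Finset.mem_range, Finset.mem_image,
      Set.mem_image, mem_thueMorseSet_iff]
    constructor
    · rintro ⟨hn, t, ht, rfl⟩
      exact ⟨t, ⟨(hlt t).1 hn, ht⟩, rfl⟩
    · rintro ⟨t, ⟨ht, hbit⟩, rfl⟩
      exact ⟨(hlt t).2 ht, t, hbit, rfl⟩
  have hinj : Function.Injective (m * · + r) := fun a b hab =>
    Nat.eq_of_mul_eq_mul_left (Nat.zero_lt_of_lt h) (Nat.add_right_cancel hab)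
  rw [himage, Finset.card_image_of_injective _ hinj, card_thueMorseBit_eq_zero]

/-- The `j`-th of these sets has `b ^ j` elements below `2 * m`, so the earlier ones together are
too small to cover the `i`-th. -/
theorem exists_mem_thueMorseAffine_div_pow_notMem {b i : ℕ} (hb : 1 < b) (h : r < m)
    (hi : b ^ i ∣ m) : ∃ v ∈ thueMorseAffine (m / b ^ i) (r / b ^ i),
      ∀ l < i, v ∉ thueMorseAffine (m / b ^ l) (r / b ^ l) := by
  classical
  let Y (j : ℕ) : Finset ℕ :=
    (Finset.range (2 * m)).filter (· ∈ thueMorseAffine (m / b ^ j) (r / b ^ j))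
  have hcard : ∀ j ≤ i, (Y j).card = b ^ j := by
    intro j hj
    have hdvd := (pow_dvd_pow b hj).trans hi
    have := card_filter_range_mem_thueMorseAffine (Nat.div_lt_div_of_lt_of_dvd hdvd h) (b ^ j)
    rwa [Nat.div_mul_cancel hdvd] at this
  have hlt : ((Finset.range i).biUnion Y).card < (Y i).card :=
    calc ((Finset.range i).biUnion Y).card ≤ ∑ j ∈ Finset.range i, (Y j).card :=
          Finset.card_biUnion_le
      _ = ∑ j ∈ Finset.range i, b ^ j :=
          Finset.sum_congr rfl fun j hj => hcard j (Finset.mem_range.1 hj).le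
      _ < b ^ i := Nat.geomSum_lt hb fun _ => Finset.mem_range.1
      _ = (Y i).card := (hcard i le_rfl).symm
  obtain ⟨v, hv, hnot⟩ := Finset.exists_mem_notMem_of_card_lt_card hlt
  simp only [Y, Finset.mem_filter, Finset.mem_biUnion, Finset.mem_range, not_exists, not_and]
    at hv hnot
  exact ⟨v, hv.2, fun l hl => hnot l hl hv.1⟩

end

/-! ### Words and automata -/

/-- With the accepting states `F` in place of its own, the automaton `A` accepts exactly the words
whose value lies in `Y`. -/
def RecognizesWith {b : ℕ} {σ : Type*} (A : DFA (Fin b) σ) (F : Set σ) (Y : Set ℕ) : Prop :=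
  ∀ w, A.eval w ∈ F ↔ wordVal w ∈ Y

section

variable {b : ℕ}

theorem wordVal_nil : wordVal ([] : List (Fin b)) = 0 := by simp [wordVal]

theorem wordVal_append (v w : List (Fin b)) :
    wordVal (v ++ w) = wordVal v * b ^ w.length + wordVal w := by
  simp only [wordVal, List.map_append, List.reverse_append, Nat.ofDigits_append,
    List.length_reverse, List.length_map]
  ring

theorem wordVal_append_singleton (v : List (Fin b)) (d : Fin b) :
    wordVal (v ++ [d]) = wordVal v * b + d := by
  rw [wordVal_append]
  simp [wordVal]

theorem exists_word_of_length (l n : ℕ) (h : n < b ^ l) :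
    ∃ w : List (Fin b), w.length = l ∧ wordVal w = n := by
  induction l generalizing n with
  | zero => exact ⟨[], rfl, by simp_all [wordVal_nil]⟩
  | succ l ih =>
    rw [pow_succ] at h
    have hb : 0 < b := Nat.pos_of_ne_zero fun hb => by simp [hb] at h
    obtain ⟨w, hlen, hval⟩ := ih (n / b) (Nat.div_lt_of_lt_mul (by rwa [mul_comm]))
    refine ⟨w ++ [⟨n % b, Nat.mod_lt _ hb⟩], by simp [hlen], ?_⟩
    rw [wordVal_append_singleton, hval]
    exact Nat.div_add_mod' n b

theorem exists_word (hb : 1 < b) (n : ℕ) : ∃ w : List (Fin b), wordVal w = n :=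
  (exists_word_of_length n n (Nat.lt_pow_self hb)).imp fun _ => And.right

variable {σ : Type*} {A : DFA (Fin b) σ} {F : Set σ} {Y : Set ℕ}

theorem RecognizesSet.recognizesWith (h : RecognizesSet A Y) : RecognizesWith A A.accept Y :=
  fun w => Set.ext_iff.1 h w

theorem RecognizesWith.quotient (h : RecognizesWith A F Y) (w : List (Fin b)) :
    RecognizesWith A {q | A.evalFrom q w ∈ F} {n | n * b ^ w.length + wordVal w ∈ Y} := by
  intro v
  have hvw := h (v ++ w)
  rwa [wordVal_append, DFA.eval, DFA.evalFrom_of_append] at hvw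

theorem RecognizesWith.digitQuotient (h : RecognizesWith A F Y) (d : Fin b) :
    RecognizesWith A {q | A.step q d ∈ F} {n | n * b + d ∈ Y} := by
  simpa [wordVal] using h.quotient [d]

/-! ### Lower bounds for the number of states -/

variable {m r : ℕ}

theorem RecognizesWith.thueMorseAffine_div_pow {i : ℕ} (hr : r < m) (hi : b ^ i ∣ m)
    (hA : RecognizesWith A F (thueMorseAffine m r)) :
    ∃ F', RecognizesWith A F' (thueMorseAffine (m / b ^ i) (r / b ^ i)) := by
  have hb : 0 < b ^ i := Nat.pos_of_dvd_of_pos hi (by omega)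
  have hlt := Nat.mod_lt r hb
  obtain ⟨w, hlen, hval⟩ := exists_word_of_length i (r % b ^ i) hlt
  refine ⟨_, fun v => (hA.quotient w v).trans ?_⟩
  have h := mul_add_mem_thueMorseAffine_mul_iff (m := m / b ^ i) (r := r)
    (by rwa [Nat.div_mul_cancel hi]) hlt (wordVal v)
  rw [Nat.div_mul_cancel hi] at h
  rw [Set.mem_ofPred_eq, hlen, hval, h]
  exact and_iff_right rfl

variable [Fintype σ]

/-- The words of values `v 0, …, v i` lead to different states. -/
theorem lt_card_of_forall_exists_mem_notMem (hb : 1 < b) {i : ℕ} {F : ℕ → Set σ} {Y : ℕ → Set ℕ}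
    (hA : ∀ j ≤ i, RecognizesWith A (F j) (Y j))
    (hY : ∀ j ≤ i, ∃ v ∈ Y j, ∀ l < j, v ∉ Y l) : i < Fintype.card σ := by
  choose! v hmem hnot using hY
  choose u hu using exists_word hb
  have hne : ∀ l j, l < j → j ≤ i → A.eval (u (v l)) ≠ A.eval (u (v j)) := by
    intro l j hlj hj heq
    have hl := hlj.le.trans hj
    refine hnot j hj l hlj ?_
    rw [← hu (v j), ← hA l hl, ← heq, hA l hl, hu]
    exact hmem l hl
  have hinj : Function.Injective fun j : Fin (i + 1) => A.eval (u (v j)) := by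
    intro j l heq
    rcases lt_trichotomy (j : ℕ) l with hlt | hjl | hlt
    · exact absurd heq (hne j l hlt (by omega))
    · exact Fin.ext hjl
    · exact absurd heq.symm (hne l j hlt (by omega))
  simpa using Fintype.card_le_of_injective _ hinj

theorem lt_card_of_pow_dvd (hb : 1 < b) {i : ℕ} (hr : r < m) (hi : b ^ i ∣ m)
    (hA : RecognizesWith A F (thueMorseAffine m r)) : i < Fintype.card σ := by
  have hdvd : ∀ j ≤ i, b ^ j ∣ m := fun j hj => (pow_dvd_pow b hj).trans hi
  choose! F' hF' using fun j hj => hA.thueMorseAffine_div_pow hr (hdvd j hj)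
  exact lt_card_of_forall_exists_mem_notMem hb hF' fun j hj =>
    exists_mem_thueMorseAffine_div_pow_notMem hb hr (hdvd j hj)

/-- Words whose values differ modulo `k` are told apart by a suffix completing one of them to an
element of `m T + r`. -/
theorem le_card_of_coprime_dvd (hb : 1 < b) {k : ℕ} (hr : r < m) (hk : k ∣ m)
    (hkb : k.Coprime b) (hA : RecognizesWith A F (thueMorseAffine m r)) :
    k ≤ Fintype.card σ := by
  choose u hu using exists_word hb
  have hinj : Function.Injective fun j : Fin k => A.eval (u j) := by
    intro j l heq
    obtain ⟨x, hx, hj⟩ := exists_add_mem_thueMorseAffine hr (j * b ^ (4 * m))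
    obtain ⟨w, hlen, hval⟩ := exists_word_of_length (b := b) (4 * m) x
      (hx.trans (Nat.lt_pow_self hb))
    have hl : (l : ℕ) * b ^ (4 * m) + x ∈ thueMorseAffine m r := by
      have hjw := hA.quotient w (u j)
      have hlw := hA.quotient w (u l)
      simp only [hu, hlen, hval, Set.mem_ofPred_eq] at hjw hlw
      exact hlw.1 (congrArg (A.evalFrom · w) heq ▸ hjw.2 hj)
    rw [mem_thueMorseAffine_iff hr] at hj hl
    have hmodm : (j : ℕ) * b ^ (4 * m) ≡ l * b ^ (4 * m) [MOD m] :=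
      Nat.ModEq.add_right_cancel' x (hj.1.trans hl.1.symm)
    have hmodk : (j : ℕ) ≡ l [MOD k] :=
      Nat.ModEq.cancel_right_of_coprime (hkb.pow_right _) (hmodm.of_dvd hk)
    exact Fin.ext (hmodk.eq_of_lt_of_lt j.2 l.2)
  simpa using Fintype.card_le_of_injective _ hinj

end

theorem le_two_pow_mul_card {p m r : ℕ} {σ : Type*} [Fintype σ] {A : DFA (Fin (2 ^ p)) σ}
    {F : Set σ} (hr : r < m) (hm : ¬ 2 ^ p ∣ m)
    (hA : RecognizesWith A F (thueMorseAffine m r)) : m ≤ 2 ^ p * Fintype.card σ := by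
  obtain ⟨z, k, hk, rfl⟩ := Nat.exists_eq_two_pow_mul_odd (n := m) (by omega)
  have hz : z < p := by
    by_contra hz
    exact hm ((pow_dvd_pow 2 (not_lt.1 hz)).trans (dvd_mul_right _ _))
  have hkσ : k ≤ Fintype.card σ :=
    le_card_of_coprime_dvd (Nat.one_lt_two_pow (by omega)) hr (dvd_mul_left _ _)
      ((Nat.coprime_two_right.2 hk).pow_right p) hA
  exact Nat.mul_le_mul (Nat.pow_le_pow_right two_pos hz.le) hkσ

/-! ### Stripping a common last digit -/

/-- The last digits in base `b` of the elements of `Y`. -/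
def lastDigits (b : ℕ) (Y : Set ℕ) : Set ℕ := (· % b) '' Y

open Classical in
/-- Remove the last digit in base `b` from all elements of `Y` if they share it; otherwise leave
`Y` as it is. -/
noncomputable def stripDigit (b : ℕ) (Y : Set ℕ) : Set ℕ :=
  if ∃ d, lastDigits b Y = {d} then (· / b) '' Y else Y

section

variable {b d m r : ℕ} {Y : Set ℕ}

theorem mul_add_mem_iff_of_lastDigits_eq (hd : d < b) (h : lastDigits b Y = {d}) (n : ℕ) :
    n * b + d ∈ Y ↔ n ∈ (· / b) '' Y := by
  constructor
  · intro hn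
    exact ⟨_, hn, mul_add_div_of_lt hd⟩
  · rintro ⟨x, hx, rfl⟩
    have hmod : x % b = d := h.subset ⟨x, hx, rfl⟩
    rwa [← hmod, Nat.div_add_mod']

theorem stripDigit_of_lastDigits_eq (hd : d < b) (h : lastDigits b Y = {d}) :
    stripDigit b Y = {n | n * b + d ∈ Y} := by
  rw [stripDigit, if_pos ⟨d, h⟩]
  exact Set.ext fun n => (mul_add_mem_iff_of_lastDigits_eq hd h n).symm

theorem lastDigits_thueMorseAffine_mul (h : r < m * b) :
    lastDigits b (thueMorseAffine (m * b) r) = {r % b} := by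
  have hb : 0 < b := Nat.pos_of_mul_pos_left (Nat.zero_lt_of_lt h)
  refine Set.eq_singleton_iff_unique_mem.2 ⟨⟨r, self_mem_thueMorseAffine h, rfl⟩, ?_⟩
  rintro _ ⟨x, hx, rfl⟩
  rw [← Nat.div_add_mod' x b] at hx
  exact ((mul_add_mem_thueMorseAffine_mul_iff h (Nat.mod_lt _ hb) _).1 hx).1

theorem stripDigit_thueMorseAffine_mul (h : r < m * b) :
    stripDigit b (thueMorseAffine (m * b) r) = thueMorseAffine m (r / b) := by
  have hlt : r % b < b := Nat.mod_lt _ (Nat.pos_of_mul_pos_left (Nat.zero_lt_of_lt h))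
  rw [stripDigit_of_lastDigits_eq hlt (lastDigits_thueMorseAffine_mul h)]
  ext n
  exact (mul_add_mem_thueMorseAffine_mul_iff h hlt n).trans (and_iff_right rfl)

/-- The elements `r` and `r + 3 * m` have different last digits. -/
theorem lastDigits_thueMorseAffine_ne (hb : b.Coprime 3) (h : r < m) (hm : ¬ b ∣ m) :
    lastDigits b (thueMorseAffine m r) ≠ {d} := by
  intro hd
  have hr : r % b = d := hd.subset ⟨r, self_mem_thueMorseAffine h, rfl⟩
  have hr3 : (r + 3 * m) % b = d := hd.subset ⟨_, add_three_mul_mem_thueMorseAffine h, rfl⟩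
  have hdvd : b ∣ r + 3 * m - r := (Nat.modEq_iff_dvd' (by omega)).1 (hr.trans hr3.symm)
  rw [Nat.add_sub_cancel_left] at hdvd
  exact hm (hb.dvd_of_dvd_mul_left hdvd)

theorem stripDigit_thueMorseAffine_of_not_dvd (hb : b.Coprime 3) (h : r < m) (hm : ¬ b ∣ m) :
    stripDigit b (thueMorseAffine m r) = thueMorseAffine m r :=
  if_neg fun ⟨_, hd⟩ => lastDigits_thueMorseAffine_ne hb h hm hd

theorem eq_thueMorseAffine_mul_of_image_div (hd : d < b) (hY : lastDigits b Y = {d}) (h : r < m)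
    (hdiv : (· / b) '' Y = thueMorseAffine m r) : Y = thueMorseAffine (m * b) (r * b + d) := by
  ext x
  have hx := Nat.div_add_mod' x b
  have hmod : x % b < b := Nat.mod_lt _ (by omega)
  rw [← hx, mul_add_mem_thueMorseAffine_mul_iff (mul_add_lt_mul h hd) hmod, Nat.mul_add_mod',
    Nat.mod_eq_of_lt hd, mul_add_div_of_lt hd, ← hdiv]
  constructor
  · intro hxY
    have hlast : x % b = d := by
      rw [hx] at hxY
      exact hY.subset ⟨x, hxY, rfl⟩
    rw [hlast] at hxY
    exact ⟨hlast, (mul_add_mem_iff_of_lastDigits_eq hd hY _).1 hxY⟩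
  · rintro ⟨hlast, hrest⟩
    rw [hlast]
    exact (mul_add_mem_iff_of_lastDigits_eq hd hY _).2 hrest

theorem isThueMorseAffine_stripDigit_iff (hb : 0 < b) (hb3 : b.Coprime 3) :
    IsThueMorseAffine (stripDigit b Y) ↔ IsThueMorseAffine Y := by
  constructor
  · rintro ⟨m, r, h, heq⟩
    by_cases hY : ∃ d, lastDigits b Y = {d}
    · rw [stripDigit, if_pos hY] at heq
      obtain ⟨d, hd⟩ := hY
      obtain ⟨x, -, rfl⟩ : d ∈ lastDigits b Y := hd ▸ rfl
      have hlt := Nat.mod_lt x hb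
      exact ⟨_, _, mul_add_lt_mul h hlt, eq_thueMorseAffine_mul_of_image_div hlt hd h heq⟩
    · rw [stripDigit, if_neg hY] at heq
      exact ⟨m, r, h, heq⟩
  · rintro ⟨m, r, h, rfl⟩
    by_cases hm : b ∣ m
    · obtain ⟨k, rfl⟩ := hm
      rw [mul_comm b] at h ⊢
      exact ⟨k, r / b, Nat.div_lt_of_lt_mul (by rwa [mul_comm]), stripDigit_thueMorseAffine_mul h⟩
    · exact ⟨m, r, h, stripDigit_thueMorseAffine_of_not_dvd hb3 h hm⟩

theorem isThueMorseAffine_iterate_stripDigit_iff (hb : 0 < b) (hb3 : b.Coprime 3) (k : ℕ) :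
    IsThueMorseAffine ((stripDigit b)^[k] Y) ↔ IsThueMorseAffine Y := by
  induction k with
  | zero => rfl
  | succ k ih => rw [Function.iterate_succ_apply', isThueMorseAffine_stripDigit_iff hb hb3, ih]

theorem iterate_stripDigit_thueMorseAffine_mul_pow (hb : b.Coprime 3) (hm : ¬ b ∣ m) {e k : ℕ}
    (h : r < m * b ^ e) (hek : e ≤ k) :
    (stripDigit b)^[k] (thueMorseAffine (m * b ^ e) r) = thueMorseAffine m (r / b ^ e) := by
  induction e generalizing r k with
  | zero =>
    simp only [pow_zero, mul_one, Nat.div_one] at h ⊢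
    exact Function.iterate_fixed (stripDigit_thueMorseAffine_of_not_dvd hb h hm) k
  | succ e ih =>
    obtain ⟨k, rfl⟩ : ∃ l, k = l + 1 := ⟨k - 1, by omega⟩
    rw [pow_succ, ← mul_assoc] at h ⊢
    rw [Function.iterate_succ_apply, stripDigit_thueMorseAffine_mul h,
      ih (Nat.div_lt_of_lt_mul (by rwa [mul_comm b])) (by omega), Nat.div_div_eq_div_mul,
      mul_comm b]

theorem exists_iterate_stripDigit_eq_thueMorseAffine {σ : Type*} [Fintype σ] {A : DFA (Fin b) σ}
    {F : Set σ} (hb : 1 < b) (hb3 : b.Coprime 3) (hA : RecognizesWith A F Y)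
    (hY : IsThueMorseAffine Y) : ∃ m r, r < m ∧ ¬ b ∣ m ∧
      (stripDigit b)^[Fintype.card σ] Y = thueMorseAffine m r := by
  obtain ⟨m, r, hr, rfl⟩ := hY
  obtain ⟨e, k, hk, rfl⟩ := Nat.exists_eq_pow_mul_and_not_dvd (n := m) (by omega) b (by omega)
  have he := lt_card_of_pow_dvd hb hr (dvd_mul_right _ _) hA
  rw [mul_comm] at hr ⊢
  exact ⟨k, r / b ^ e, Nat.div_lt_of_lt_mul (by rwa [mul_comm]), hk,
    iterate_stripDigit_thueMorseAffine_mul_pow hb3 hk hr he.le⟩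

end

/-! ### A structured language over random access machines -/

/-- The values of the variables and arrays of a structured program. -/
structure State (V A : Type*) where
  reg : V → ℕ
  arr : A → ℕ → ℕ

/-- The operation `o` applied to `m` and `n`, which are at most `W`, gives at most `W`. Only
addition and multiplication can exceed their first argument. -/
def NoOverflow (W : ℕ) : RAM.Op → ℕ → ℕ → Prop
  | .add, m, n => m + n ≤ W
  | .mul, m, n => m * n ≤ W
  | .sub, _, _ => True
  | .div, _, _ => True

/-- Arithmetic expressions over variables and array cells. -/
inductive ArithExpr (V A : Type*)
  | var (x : V)
  | lit (n : ℕ)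
  | op (o : RAM.Op) (e f : ArithExpr V A)
  | get (a : A) (e : ArithExpr V A)

/-- Comparisons of numbers. -/
inductive Comparison
  | lt | eq

/-- The relation between numbers that a comparison tests. -/
def Comparison.Holds : Comparison → ℕ → ℕ → Prop
  | .lt, m, n => m < n
  | .eq, m, n => m = n

instance (c : Comparison) (m n : ℕ) : Decidable (c.Holds m n) :=
  match c with
  | .lt => inferInstanceAs (Decidable (m < n))
  | .eq => inferInstanceAs (Decidable (m = n))

/-- Structured programs. In `loop x n P`, the variable `x` runs from `0` to `n - 1`. -/
inductive Cmd (V A : Type*)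
  | skip
  | assign (x : V) (e : ArithExpr V A)
  | put (a : A) (e f : ArithExpr V A)
  | seq (P Q : Cmd V A)
  | ite (c : Comparison) (e f : ArithExpr V A) (P Q : Cmd V A)
  | loop (x n : V) (P : Cmd V A)

infixr:60 " ;; " => Cmd.seq

/-- A conditional without alternative. -/
def Cmd.when {V A : Type*} (c : Comparison) (e f : ArithExpr V A) (P : Cmd V A) : Cmd V A :=
  .ite c e f P .skip

namespace State

variable {V A : Type*} {W : ℕ} {s : State V A}

/-- Replace the value of the variable `x` by `v`. -/
def setReg [DecidableEq V] (s : State V A) (x : V) (v : ℕ) : State V A :=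
  { s with reg := Function.update s.reg x v }

/-- Replace the value of the cell `i` of the array `a` by `v`. -/
def setArr [DecidableEq A] (s : State V A) (a : A) (i v : ℕ) : State V A :=
  { s with arr := Function.update s.arr a (Function.update (s.arr a) i v) }

/-- All values fit into words holding the numbers `0, …, W`. -/
def Bounded (W : ℕ) (s : State V A) : Prop :=
  (∀ x, s.reg x ≤ W) ∧ ∀ a i, s.arr a i ≤ W

@[simp] theorem setReg_reg [DecidableEq V] (s : State V A) (x : V) (v : ℕ) (y : V) :
    (s.setReg x v).reg y = if y = x then v else s.reg y := by
  simp [setReg, Function.update_apply]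

@[simp] theorem setReg_arr [DecidableEq V] (s : State V A) (x : V) (v : ℕ) :
    (s.setReg x v).arr = s.arr := rfl

@[simp] theorem setArr_reg [DecidableEq A] (s : State V A) (a : A) (i v : ℕ) :
    (s.setArr a i v).reg = s.reg := rfl

@[simp] theorem setArr_arr [DecidableEq A] (s : State V A) (a : A) (i v : ℕ) (c : A) :
    (s.setArr a i v).arr c = if c = a then Function.update (s.arr a) i v else s.arr c := by
  simp [setArr, Function.update_apply]

theorem Bounded.setReg [DecidableEq V] (h : s.Bounded W) (x : V) {v : ℕ} (hv : v ≤ W) :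
    (s.setReg x v).Bounded W := by
  refine ⟨fun y => ?_, h.2⟩
  rw [setReg_reg]
  split_ifs
  exacts [hv, h.1 y]

theorem Bounded.setArr [DecidableEq A] (h : s.Bounded W) (a : A) (i : ℕ) {v : ℕ}
    (hv : v ≤ W) : (s.setArr a i v).Bounded W := by
  refine ⟨h.1, fun c j => ?_⟩
  rw [setArr_arr]
  split_ifs
  · rw [Function.update_apply]
    split_ifs
    exacts [hv, h.2 a j]
  · exact h.2 c j

end State

namespace ArithExpr

variable {V A : Type*}

instance : Add (ArithExpr V A) := ⟨.op .add⟩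
instance : Sub (ArithExpr V A) := ⟨.op .sub⟩
instance : Mul (ArithExpr V A) := ⟨.op .mul⟩
instance : Div (ArithExpr V A) := ⟨.op .div⟩
instance : Mod (ArithExpr V A) := ⟨fun e f => e - e / f * f⟩

/-- The value of an expression. -/
def eval (s : State V A) : ArithExpr V A → ℕ
  | var x => s.reg x
  | lit n => n
  | op o e f => o.eval (e.eval s) (f.eval s)
  | get a e => s.arr a (e.eval s)

/-- The evaluation of the expression does not exceed `W` if the values in `s` do not. -/
def Ok (W : ℕ) (s : State V A) : ArithExpr V A → Prop
  | var _ => True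
  | lit n => n ≤ W
  | op o e f => e.Ok W s ∧ f.Ok W s ∧ NoOverflow W o (e.eval s) (f.eval s)
  | get _ e => e.Ok W s

/-- The number of elementary steps of the evaluation. -/
def cost : ArithExpr V A → ℕ
  | var _ => 2
  | lit _ => 1
  | op _ e f => e.cost + (f.cost + 1)
  | get _ e => e.cost + 1

section

variable {W : ℕ} (s : State V A) (e f : ArithExpr V A)

@[simp] theorem eval_var (x : V) : (var x).eval s = s.reg x := rfl
@[simp] theorem eval_lit (n : ℕ) : (lit n).eval s = n := rfl
@[simp] theorem eval_add : (e + f).eval s = e.eval s + f.eval s := rfl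
@[simp] theorem eval_sub : (e - f).eval s = e.eval s - f.eval s := rfl
@[simp] theorem eval_mul : (e * f).eval s = e.eval s * f.eval s := rfl
@[simp] theorem eval_div : (e / f).eval s = e.eval s / f.eval s := rfl
@[simp] theorem eval_get (a : A) : (get a e).eval s = s.arr a (e.eval s) := rfl

@[simp] theorem eval_mod : (e % f).eval s = e.eval s % f.eval s := by
  rw [Nat.mod_eq_sub_div_mul]
  rfl

@[simp] theorem ok_var (x : V) : (var x).Ok W s := trivial
@[simp] theorem ok_lit (n : ℕ) : (lit n).Ok W s ↔ n ≤ W := Iff.rfl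
@[simp] theorem ok_add : (e + f).Ok W s ↔ e.Ok W s ∧ f.Ok W s ∧ e.eval s + f.eval s ≤ W :=
  Iff.rfl
@[simp] theorem ok_mul : (e * f).Ok W s ↔ e.Ok W s ∧ f.Ok W s ∧ e.eval s * f.eval s ≤ W :=
  Iff.rfl
@[simp] theorem ok_get (a : A) : (get a e).Ok W s ↔ e.Ok W s := Iff.rfl

@[simp] theorem ok_sub : (e - f).Ok W s ↔ e.Ok W s ∧ f.Ok W s :=
  and_congr_right fun _ => and_iff_left trivial

@[simp] theorem ok_div : (e / f).Ok W s ↔ e.Ok W s ∧ f.Ok W s :=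
  and_congr_right fun _ => and_iff_left trivial

@[simp] theorem ok_mod : (e % f).Ok W s ↔
    e.Ok W s ∧ f.Ok W s ∧ e.eval s / f.eval s * f.eval s ≤ W := by
  change (e - e / f * f).Ok W s ↔ _
  simp only [ok_sub, ok_mul, ok_div, eval_div]
  tauto

@[simp] theorem cost_var (x : V) : (var x : ArithExpr V A).cost = 2 := rfl
@[simp] theorem cost_lit (n : ℕ) : (lit n : ArithExpr V A).cost = 1 := rfl
@[simp] theorem cost_add : (e + f).cost = e.cost + (f.cost + 1) := rfl
@[simp] theorem cost_sub : (e - f).cost = e.cost + (f.cost + 1) := rfl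
@[simp] theorem cost_mul : (e * f).cost = e.cost + (f.cost + 1) := rfl
@[simp] theorem cost_div : (e / f).cost = e.cost + (f.cost + 1) := rfl
@[simp] theorem cost_mod : (e % f).cost = e.cost + (e.cost + (f.cost + 1) + (f.cost + 1) + 1) := rfl
@[simp] theorem cost_get (a : A) : (get a e).cost = e.cost + 1 := rfl

end

theorem eval_le {W : ℕ} {s : State V A} (hs : s.Bounded W) {e : ArithExpr V A} (he : e.Ok W s) :
    e.eval s ≤ W := by
  induction e with
  | var x => exact hs.1 x
  | lit n => exact he
  | op o e f ihe _ =>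
    obtain ⟨hoke, -, hfit⟩ := he
    cases o
    · exact hfit
    · exact (Nat.sub_le _ _).trans (ihe hoke)
    · exact hfit
    · exact (Nat.div_le_self _ _).trans (ihe hoke)
  | get a e => exact hs.2 a _

end ArithExpr

namespace Cmd

variable {V A : Type*}

/-- The variables that a program may change. -/
def regs : Cmd V A → List V
  | skip => []
  | assign x _ => [x]
  | put _ _ _ => []
  | seq P Q => P.regs ++ Q.regs
  | ite _ _ _ P Q => P.regs ++ Q.regs
  | loop x _ P => x :: P.regs

/-- The arrays that a program may change. -/
def arrs : Cmd V A → List A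
  | skip => []
  | assign _ _ => []
  | put a _ _ => [a]
  | seq P Q => P.arrs ++ Q.arrs
  | ite _ _ _ P Q => P.arrs ++ Q.arrs
  | loop _ _ P => P.arrs

variable [DecidableEq V]

/-- The state before round `k` of a loop over `x` whose body acts as `F`. -/
def iter (x : V) (F : State V A → State V A) (s : State V A) : ℕ → State V A
  | 0 => s.setReg x 0
  | k + 1 => (F (iter x F s k)).setReg x (k + 1)

theorem iter_reg_self (x : V) (F : State V A → State V A) (s : State V A) (k : ℕ) :
    (iter x F s k).reg x = k := by
  cases k <;> simp [iter]

theorem bounded_iter {W : ℕ} {x : V} {F : State V A → State V A} {s : State V A}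
    (hs : s.Bounded W) {l : ℕ} (hl : l ≤ W)
    (hF : ∀ k < l, (iter x F s k).Bounded W → (F (iter x F s k)).Bounded W) :
    (iter x F s l).Bounded W := by
  induction l with
  | zero => exact hs.setReg x hl
  | succ l ih =>
    exact (hF l l.lt_succ_self (ih (by omega) fun k hk => hF k (by omega))).setReg x hl

variable [DecidableEq A]

/-- The effect of a program. -/
def run : Cmd V A → State V A → State V A
  | skip => fun s => s
  | assign x e => fun s => s.setReg x (e.eval s)
  | put a e f => fun s => s.setArr a (e.eval s) (f.eval s)
  | seq P Q => fun s => Q.run (P.run s)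
  | ite c e f P Q => fun s => if c.Holds (e.eval s) (f.eval s) then P.run s else Q.run s
  | loop x n P => fun s => iter x P.run s (s.reg n)

/-- No computed number exceeds `W`, loops up to `n` have at most `β n` rounds, and the bodies of
loops change neither the loop variable nor the bound. -/
def Ok (W : ℕ) (β : V → ℕ) : Cmd V A → State V A → Prop
  | skip => fun _ => True
  | assign _ e => fun s => e.Ok W s
  | put _ e f => fun s => e.Ok W s ∧ f.Ok W s
  | seq P Q => fun s => P.Ok W β s ∧ Q.Ok W β (P.run s)
  | ite c e f P Q => fun s => e.Ok W s ∧ f.Ok W s ∧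
      (c.Holds (e.eval s) (f.eval s) → P.Ok W β s) ∧
      (¬ c.Holds (e.eval s) (f.eval s) → Q.Ok W β s)
  | loop x n P => fun s => (x ≠ n ∧ x ∉ P.regs ∧ n ∉ P.regs) ∧ s.reg n ≤ β n ∧
      ∀ k < s.reg n, P.Ok W β (iter x P.run s k)

/-- A bound for the number of elementary steps, if loops up to `n` have at most `β n` rounds. -/
def cost (β : V → ℕ) : Cmd V A → ℕ
  | skip => 1
  | assign _ e => e.cost + 2
  | put _ e f => e.cost + (f.cost + 1)
  | seq P Q => P.cost β + Q.cost β
  | ite _ e f P Q => e.cost + (f.cost + (1 + (P.cost β + Q.cost β)))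
  | loop _ n P => β n * (P.cost β + 3) + 2

/-- The states `s` and `s'` agree on everything that `P` cannot change. -/
structure AgreeOff (P : Cmd V A) (s s' : State V A) : Prop where
  reg : ∀ x ∉ P.regs, s'.reg x = s.reg x
  arr : ∀ a ∉ P.arrs, s'.arr a = s.arr a

theorem agreeOff_loop_iter {x n : V} {P : Cmd V A} (hP : ∀ s, P.AgreeOff s (P.run s))
    (s : State V A) (k : ℕ) : (loop x n P).AgreeOff s (iter x P.run s k) := by
  induction k with
  | zero =>
    refine ⟨fun y hy => ?_, fun _ _ => rfl⟩
    simp only [regs, List.mem_cons, not_or] at hy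
    simp [iter, hy.1]
  | succ k ih =>
    refine ⟨fun y hy => ?_, fun a ha => ?_⟩
    · have hne := hy
      simp only [regs, List.mem_cons, not_or] at hne
      rw [iter, State.setReg_reg, if_neg hne.1, (hP _).reg y hne.2, ih.reg y hy]
    · rw [iter, State.setReg_arr, (hP _).arr a ha, ih.arr a ha]

theorem agreeOff_run (P : Cmd V A) (s : State V A) : P.AgreeOff s (P.run s) := by
  induction P generalizing s with
  | skip => exact ⟨fun _ _ => rfl, fun _ _ => rfl⟩
  | assign x e =>
    refine ⟨fun y hy => ?_, fun _ _ => rfl⟩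
    rw [run, State.setReg_reg, if_neg (List.mem_singleton.not.1 hy)]
  | put a e f =>
    refine ⟨fun _ _ => rfl, fun c hc => ?_⟩
    rw [run, State.setArr_arr, if_neg (List.mem_singleton.not.1 hc)]
  | seq P Q ihP ihQ =>
    simp only [run]
    constructor <;> simp only [regs, arrs, List.mem_append, not_or, and_imp]
    · exact fun y hyP hyQ => ((ihQ _).reg y hyQ).trans ((ihP s).reg y hyP)
    · exact fun a haP haQ => ((ihQ _).arr a haQ).trans ((ihP s).arr a haP)
  | ite c e f P Q ihP ihQ =>
    simp only [run]
    constructor <;> simp only [regs, arrs, List.mem_append, not_or, and_imp] <;> split_ifs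
    · exact fun y hyP _ => (ihP s).reg y hyP
    · exact fun y _ hyQ => (ihQ s).reg y hyQ
    · exact fun a haP _ => (ihP s).arr a haP
    · exact fun a _ haQ => (ihQ s).arr a haQ
  | loop x n P ih => exact agreeOff_loop_iter ih s _

theorem bounded_run {W : ℕ} {β : V → ℕ} {P : Cmd V A} {s : State V A} (hs : s.Bounded W)
    (hP : P.Ok W β s) : (P.run s).Bounded W := by
  induction P generalizing s with
  | skip => exact hs
  | assign x e => exact hs.setReg x (ArithExpr.eval_le hs hP)
  | put a e f => exact hs.setArr a _ (ArithExpr.eval_le hs hP.2)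
  | seq P Q ihP ihQ => exact ihQ (ihP hs hP.1) hP.2
  | ite c e f P Q ihP ihQ =>
    simp only [run]
    split_ifs with h
    · exact ihP hs (hP.2.2.1 h)
    · exact ihQ hs (hP.2.2.2 h)
  | loop x n P ih => exact bounded_iter hs (hs.1 n) fun k hk hb => ih hb (hP.2.2 k hk)

end Cmd

/-! ### Compiling structured programs -/

namespace RAM

theorem Store.setReg_reg (st : Store) (x v y : ℕ) :
    (st.setReg x v).reg y = if y = x then v else st.reg y := by
  simp [Store.setReg, Function.update_apply]

/-- The contents of the machine agree in the registers below `n` and in all arrays. -/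
def AgreeBelow (n : ℕ) (st st' : Store) : Prop :=
  (∀ x < n, st'.reg x = st.reg x) ∧ st'.arr = st.arr

theorem AgreeBelow.trans {n n' : ℕ} (hn : n ≤ n') {st st' st'' : Store} (h : AgreeBelow n st st')
    (h' : AgreeBelow n' st' st'') : AgreeBelow n st st'' :=
  ⟨fun x hx => (h'.1 x (hx.trans_le hn)).trans (h.1 x hx), h'.2.trans h.2⟩

theorem agreeBelow_setReg {n x : ℕ} (hx : n ≤ x) (st : Store) (v : ℕ) :
    AgreeBelow n st (st.setReg x v) :=
  ⟨fun y hy => by rw [Store.setReg_reg, if_neg (hy.trans_le hx).ne], rfl⟩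

/-- The program `P` started in `st` halts after at most `t` steps in a state that satisfies `R`. -/
def HaltsWithin (W : ℕ) (P : Program) (t : ℕ) (st : Store) (R : Store → Prop) : Prop :=
  ∃ t' ≤ t, ∃ st', Exec W P st t' st' ∧ R st'

section

variable {W : ℕ} {P Q : Program} {t u : ℕ} {st : Store} {R R' : Store → Prop}

theorem HaltsWithin.mono (h : HaltsWithin W P t st R) (ht : t ≤ u) (hR : ∀ st, R st → R' st) :
    HaltsWithin W P u st R' := by
  obtain ⟨t', ht', st', hexec, hpost⟩ := h
  exact ⟨t', ht'.trans ht, st', hexec, hR st' hpost⟩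

theorem HaltsWithin.seq (hP : HaltsWithin W P t st R)
    (hQ : ∀ st, R st → HaltsWithin W Q u st R') : HaltsWithin W (.seq P Q) (t + u) st R' := by
  obtain ⟨t', ht, st', hexecP, hst'⟩ := hP
  obtain ⟨u', hu, st'', hexecQ, hst''⟩ := hQ st' hst'
  exact ⟨t' + u', Nat.add_le_add ht hu, st'', .seq hexecP hexecQ, hst''⟩

theorem haltsWithin_const {x n : ℕ} (hn : n ≤ W) (hR : R (st.setReg x n)) :
    HaltsWithin W (.const x n) 1 st R :=
  ⟨1, le_rfl, _, .const _ _ _ hn, hR⟩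

theorem haltsWithin_op {o : Op} {x y z v : ℕ} (hv : o.eval (st.reg y) (st.reg z) = v) (hvW : v ≤ W)
    (hR : R (st.setReg x v)) : HaltsWithin W (.op o x y z) 1 st R := by
  subst hv
  exact ⟨1, le_rfl, _, .op _ _ _ _ _ hvW, hR⟩

theorem haltsWithin_load {x a y : ℕ} (hW : st.arr a (st.reg y) ≤ W)
    (hR : R (st.setReg x (st.arr a (st.reg y)))) : HaltsWithin W (.load x a y) 1 st R :=
  ⟨1, le_rfl, _, .load _ _ _ _ hW, hR⟩

theorem haltsWithin_store {a x y : ℕ} (hW : st.reg y ≤ W)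
    (hR : R (st.setArr a (st.reg x) (st.reg y))) : HaltsWithin W (.store a x y) 1 st R :=
  ⟨1, le_rfl, _, .store _ _ _ _ hW, hR⟩

theorem haltsWithin_ite {c : Test} (hP : c.holds st → HaltsWithin W P t st R)
    (hQ : ¬ c.holds st → HaltsWithin W Q u st R) :
    HaltsWithin W (.ite c P Q) (1 + (t + u)) st R := by
  by_cases hc : c.holds st
  · obtain ⟨t', ht, st', hexec, hst'⟩ := hP hc
    exact ⟨1 + t', by omega, st', .iteTrue hc hexec, hst'⟩
  · obtain ⟨u', hu, st', hexec, hst'⟩ := hQ hc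
    exact ⟨1 + u', by omega, st', .iteFalse hc hexec, hst'⟩

theorem haltsWithin_while {c : Test} {I : ℕ → Store → Prop} {l : ℕ}
    (hbody : ∀ k < l, ∀ st, I k st → c.holds st ∧ HaltsWithin W P t st (I (k + 1)))
    (hexit : ∀ st, I l st → ¬ c.holds st) (hst : I 0 st) :
    HaltsWithin W (.while c P) (l * (t + 1) + 1) st (I l) := by
  suffices ∀ j k st, k + j = l → I k st →
      HaltsWithin W (.while c P) (j * (t + 1) + 1) st (I l) from this l 0 st (zero_add l) hst
  intro j
  induction j with
  | zero =>
    rintro k st rfl hk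
    exact ⟨1, by omega, st, .whileFalse (hexit st hk), hk⟩
  | succ j ih =>
    intro k st hkj hk
    obtain ⟨hc, t₁, ht₁, st₁, hexec₁, hk₁⟩ := hbody k (by omega) st hk
    obtain ⟨t₂, ht₂, st₂, hexec₂, hl⟩ := ih (k + 1) st₁ (by omega) hk₁
    refine ⟨1 + t₁ + t₂, ?_, st₂, .whileTrue hc hexec₁ hexec₂, hl⟩
    rw [Nat.succ_mul]
    omega

end

end RAM

/-- The test of a comparison between two registers. -/
def Comparison.test : Comparison → ℕ → ℕ → RAM.Test
  | .lt, x, y => .lt x y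
  | .eq, x, y => .eq x y

theorem Comparison.test_holds (c : Comparison) (x y : ℕ) (st : RAM.Store) :
    (c.test x y).holds st ↔ c.Holds (st.reg x) (st.reg y) := by
  cases c <;> rfl

/-- An assignment of registers and arrays of the machine to variables and arrays of structured
programs. The registers from `scratch` on hold intermediate results. -/
structure Layout (V A : Type*) where
  reg : V → ℕ
  arr : A → ℕ
  reg_injective : Function.Injective reg
  arr_injective : Function.Injective arr
  scratch : ℕ
  reg_lt_scratch (x : V) : reg x < scratch

/-- The contents `st` of the machine represent the state `s`. -/
structure Layout.Represents {V A : Type*} (L : Layout V A) (st : RAM.Store) (s : State V A) :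
    Prop where
  reg (x : V) : st.reg (L.reg x) = s.reg x
  arr (a : A) : st.arr (L.arr a) = s.arr a

/-- The program that computes the value of an expression in the register `L.scratch + k`, using
only registers from there on. -/
def ArithExpr.compile {V A : Type*} (L : Layout V A) : ArithExpr V A → ℕ → RAM.Program
  | var x, k => .seq (.const (L.scratch + k) 0)
      (.op .add (L.scratch + k) (L.reg x) (L.scratch + k))
  | lit n, k => .const (L.scratch + k) n
  | op o e f, k => .seq (e.compile L k) (.seq (f.compile L (k + 1))
      (.op o (L.scratch + k) (L.scratch + k) (L.scratch + (k + 1))))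
  | get a e, k => .seq (e.compile L k) (.load (L.scratch + k) (L.arr a) (L.scratch + k))

/-- The translation of a structured program for the machine. -/
def Cmd.compile {V A : Type*} (L : Layout V A) : Cmd V A → RAM.Program
  | skip => .skip
  | assign x e => .seq (e.compile L 0)
      (.seq (.const (L.scratch + 1) 0) (.op .add (L.reg x) (L.scratch + 0) (L.scratch + 1)))
  | put a e f => .seq (e.compile L 0)
      (.seq (f.compile L 1) (.store (L.arr a) (L.scratch + 0) (L.scratch + 1)))
  | seq P Q => .seq (P.compile L) (Q.compile L)
  | ite c e f P Q => .seq (e.compile L 0) (.seq (f.compile L 1)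
      (.ite (c.test (L.scratch + 0) (L.scratch + 1)) (P.compile L) (Q.compile L)))
  | loop x n P => .seq (.const (L.reg x) 0) (.while (.lt (L.reg x) (L.reg n))
      (.seq (P.compile L)
        (.seq (.const L.scratch 1) (.op .add (L.reg x) (L.reg x) L.scratch))))

section

variable {V A : Type*} {L : Layout V A} {W : ℕ} {st st' : RAM.Store} {s : State V A}

theorem Layout.Represents.of_agreeBelow (h : L.Represents st s) {k : ℕ}
    (hagree : RAM.AgreeBelow (L.scratch + k) st st') : L.Represents st' s :=
  ⟨fun x => (hagree.1 _ ((L.reg_lt_scratch x).trans_le (Nat.le_add_right _ _))).trans (h.reg x),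
    fun a => (congrFun hagree.2 _).trans (h.arr a)⟩

theorem Layout.Represents.setReg [DecidableEq V] (h : L.Represents st s) (x : V) (v : ℕ) :
    L.Represents (st.setReg (L.reg x) v) (s.setReg x v) :=
  ⟨fun y => by simp [RAM.Store.setReg_reg, L.reg_injective.eq_iff, h.reg], h.arr⟩

theorem Layout.Represents.setArr [DecidableEq A] (h : L.Represents st s) (a : A) (i v : ℕ) :
    L.Represents (st.setArr (L.arr a) i v) (s.setArr a i v) :=
  ⟨h.reg, fun c => by
    simp [RAM.Store.setArr, Function.update_apply, L.arr_injective.eq_iff, h.arr]⟩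

theorem ArithExpr.haltsWithin_compile {e : ArithExpr V A} (hs : s.Bounded W) (he : e.Ok W s)
    (hst : L.Represents st s) (k : ℕ) :
    RAM.HaltsWithin W (e.compile L k) e.cost st fun st' =>
      RAM.AgreeBelow (L.scratch + k) st st' ∧ st'.reg (L.scratch + k) = e.eval s := by
  have hset (st : RAM.Store) (v : ℕ) : RAM.AgreeBelow (L.scratch + k) st
      (st.setReg (L.scratch + k) v) := RAM.agreeBelow_setReg le_rfl st v
  induction e generalizing k st with
  | var x =>
    refine (RAM.haltsWithin_const W.zero_le rfl).seq fun st₁ h₁ =>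
      RAM.haltsWithin_op (v := s.reg x) ?_ (hs.1 x) ?_
    · have hne : L.reg x ≠ L.scratch + k := by have := L.reg_lt_scratch x; omega
      simp [← h₁, RAM.Op.eval, RAM.Store.setReg_reg, hne, hst.reg]
    · exact ⟨(h₁ ▸ hset st 0).trans le_rfl (hset st₁ _), by simp [RAM.Store.setReg_reg]⟩
  | lit n => exact RAM.haltsWithin_const he ⟨hset st n, by simp [RAM.Store.setReg_reg]⟩
  | op o e f ihe ihf =>
    refine (ihe he.1 hst k hset).seq fun st₁ ⟨hagree₁, heval₁⟩ =>
      (ihf he.2.1 (hst.of_agreeBelow hagree₁) (k + 1)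
        fun st v => RAM.agreeBelow_setReg le_rfl st v).seq fun st₂ ⟨hagree₂, heval₂⟩ =>
      RAM.haltsWithin_op ?_ (eval_le hs he) ?_
    · rw [heval₂, hagree₂.1 _ (by omega), heval₁, eval]
    · exact ⟨(hagree₁.trans (by omega) hagree₂).trans le_rfl (hset st₂ _),
        by simp [RAM.Store.setReg_reg]⟩
  | get a e ih =>
    refine (ih he hst k hset).seq fun st₁ ⟨hagree₁, heval₁⟩ => ?_
    have hload : st₁.arr (L.arr a) (st₁.reg (L.scratch + k)) = (get a e).eval s := by
      rw [heval₁, hagree₁.2, hst.arr, eval]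
    refine RAM.haltsWithin_load (hload ▸ eval_le hs he) ?_
    exact ⟨hagree₁.trans le_rfl (hset st₁ _), by simp [RAM.Store.setReg_reg, hload]⟩

theorem ArithExpr.haltsWithin_compile_pair {e f : ArithExpr V A} (hs : s.Bounded W)
    (he : e.Ok W s) (hf : f.Ok W s) (hst : L.Represents st s) {Q : RAM.Program} {t : ℕ}
    {R : RAM.Store → Prop}
    (hQ : ∀ st', L.Represents st' s → st'.reg (L.scratch + 0) = e.eval s →
      st'.reg (L.scratch + 1) = f.eval s → RAM.HaltsWithin W Q t st' R) :
    RAM.HaltsWithin W (.seq (e.compile L 0) (.seq (f.compile L 1) Q)) (e.cost + (f.cost + t))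
      st R := by
  refine (haltsWithin_compile hs he hst 0).seq fun st₁ ⟨hagree₁, heval₁⟩ => ?_
  have hst₁ := hst.of_agreeBelow hagree₁
  refine (haltsWithin_compile hs hf hst₁ 1).seq fun st₂ ⟨hagree₂, heval₂⟩ => ?_
  exact hQ st₂ (hst₁.of_agreeBelow hagree₂) ((hagree₂.1 _ (by omega)).trans heval₁) heval₂

theorem Cmd.haltsWithin_compile_assign [DecidableEq V] {x : V} {e : ArithExpr V A}
    (hs : s.Bounded W) (he : e.Ok W s) (hst : L.Represents st s) :
    RAM.HaltsWithin W ((Cmd.assign x e).compile L) (e.cost + 2) st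
      (L.Represents · (s.setReg x (e.eval s))) := by
  refine (ArithExpr.haltsWithin_compile hs he hst 0).seq fun st₁ ⟨hagree₁, heval₁⟩ =>
    (RAM.haltsWithin_const W.zero_le rfl).seq fun st₂ h₂ =>
    RAM.haltsWithin_op ?_ (ArithExpr.eval_le hs he)
      (((hst.of_agreeBelow hagree₁).of_agreeBelow (k := 1) ?_).setReg x _)
  · simpa [← h₂, RAM.Op.eval, RAM.Store.setReg_reg] using heval₁
  · exact h₂ ▸ RAM.agreeBelow_setReg le_rfl st₁ 0

end

namespace Cmd

variable {V A : Type*} [DecidableEq V] [DecidableEq A] {L : Layout V A} {W : ℕ} {β : V → ℕ}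
  {st : RAM.Store} {s : State V A}

theorem haltsWithin_compile_loop {x n : V} {P : Cmd V A} (hW : 1 ≤ W) (hs : s.Bounded W)
    (hok : (loop x n P).Ok W β s) (hst : L.Represents st s)
    (hP : ∀ k < s.reg n, ∀ st, L.Represents st (iter x P.run s k) →
      RAM.HaltsWithin W (P.compile L) (P.cost β) st
        (L.Represents · (P.run (iter x P.run s k)))) :
    RAM.HaltsWithin W ((loop x n P).compile L) ((loop x n P).cost β) st
      (L.Represents · ((loop x n P).run s)) := by
  obtain ⟨⟨hxn, hxP, hnP⟩, hn, -⟩ := hok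
  have hbound (k : ℕ) : (iter x P.run s k).reg n = s.reg n :=
    (agreeOff_loop_iter (n := n) (agreeOff_run P) s k).reg n (by simp [regs, hxn.symm, hnP])
  have hwhile : ∀ st, L.Represents st (s.setReg x 0) → _ := fun st hst =>
    RAM.haltsWithin_while (W := W) (c := .lt (L.reg x) (L.reg n)) (l := s.reg n)
      (I := fun k st => L.Represents st (iter x P.run s k)) (t := P.cost β + (1 + 1))
      (P := .seq (P.compile L) (.seq (.const L.scratch 1) (.op .add (L.reg x) (L.reg x) L.scratch)))
      (fun k hk st hst => ⟨?_, ?_⟩) (fun st hst => ?_) hst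
  · refine ((RAM.haltsWithin_const W.zero_le (hst.setReg x 0)).seq hwhile).mono ?_ fun _ => id
    have := Nat.mul_le_mul_right (P.cost β + (1 + 1) + 1) hn
    simp only [cost, show P.cost β + 3 = P.cost β + (1 + 1) + 1 from rfl]
    omega
  · simpa only [RAM.Test.holds, hst.reg, iter_reg_self, hbound] using hk
  · refine (hP k hk st hst).seq fun st₁ hst₁ =>
      (RAM.haltsWithin_const hW rfl).seq fun st₂ h₂ =>
      RAM.haltsWithin_op (v := k + 1) ?_ (hk.trans_le (hs.1 n)) ?_
    · simp [← h₂, RAM.Op.eval, RAM.Store.setReg_reg, (L.reg_lt_scratch x).ne, hst₁.reg,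
        (agreeOff_run P _).reg x hxP, iter_reg_self]
    · exact (hst₁.of_agreeBelow (k := 0) (h₂ ▸ RAM.agreeBelow_setReg le_rfl st₁ 1)).setReg x _
  · simp only [RAM.Test.holds, hst.reg, iter_reg_self, hbound, lt_irrefl, not_false_eq_true]

theorem haltsWithin_compile {P : Cmd V A} (hW : 1 ≤ W) (hs : s.Bounded W) (hok : P.Ok W β s)
    (hst : L.Represents st s) :
    RAM.HaltsWithin W (P.compile L) (P.cost β) st (L.Represents · (P.run s)) := by
  induction P generalizing s st with
  | skip => exact ⟨1, le_rfl, st, .skip st, hst⟩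
  | assign x e => exact haltsWithin_compile_assign hs hok hst
  | put a e f =>
    refine ArithExpr.haltsWithin_compile_pair hs hok.1 hok.2 hst fun st₁ hst₁ he hf => ?_
    refine RAM.haltsWithin_store (hf ▸ ArithExpr.eval_le hs hok.2) ?_
    rw [he, hf]
    exact hst₁.setArr a _ _
  | seq P Q ihP ihQ =>
    exact (ihP hs hok.1 hst).seq fun st₁ hst₁ => ihQ (bounded_run hs hok.1) hok.2 hst₁
  | ite c e f P Q ihP ihQ =>
    obtain ⟨he, hf, hokP, hokQ⟩ := hok
    refine ArithExpr.haltsWithin_compile_pair hs he hf hst fun st₁ hst₁ he hf => ?_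
    refine RAM.haltsWithin_ite (fun hc => ?_) (fun hc => ?_) <;>
      rw [c.test_holds, he, hf] at hc <;> simp only [run, hc, if_true, if_false]
    · exact ihP hs (hokP hc) hst₁
    · exact ihQ hs (hokQ hc) hst₁
  | loop x n P ih =>
    refine haltsWithin_compile_loop hW hs hok hst fun k hk st hst => ih ?_ (hok.2.2 k hk) hst
    refine bounded_iter hs (hk.le.trans (hs.1 n)) fun j hj hb => ?_
    exact bounded_run hb (hok.2.2 j (hj.trans hk))

end Cmd

/-! ### Specifications of structured programs -/

section

variable {V A : Type*} [DecidableEq V] [DecidableEq A]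

/-- Started in `s`, the program `P` respects the bounds of `Cmd.Ok` and establishes `R`. -/
def Spec (W : ℕ) (β : V → ℕ) (P : Cmd V A) (s : State V A) (R : State V A → Prop) : Prop :=
  P.Ok W β s ∧ R (P.run s)

variable {W : ℕ} {β : V → ℕ} {s : State V A} {R R' : State V A → Prop} {P Q : Cmd V A}

theorem spec_skip : Spec W β .skip s R ↔ R s := iff_of_eq (true_and _)

theorem spec_assign {x : V} {e : ArithExpr V A} :
    Spec W β (.assign x e) s R ↔ e.Ok W s ∧ R (s.setReg x (e.eval s)) := Iff.rfl

theorem spec_put {a : A} {e f : ArithExpr V A} :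
    Spec W β (.put a e f) s R ↔
      e.Ok W s ∧ f.Ok W s ∧ R (s.setArr a (e.eval s) (f.eval s)) := and_assoc

theorem spec_seq : Spec W β (P ;; Q) s R ↔ Spec W β P s fun s' => Spec W β Q s' R := and_assoc

theorem spec_ite {c : Comparison} {e f : ArithExpr V A} :
    Spec W β (.ite c e f P Q) s R ↔ e.Ok W s ∧ f.Ok W s ∧
      (c.Holds (e.eval s) (f.eval s) → Spec W β P s R) ∧
      (¬ c.Holds (e.eval s) (f.eval s) → Spec W β Q s R) := by
  by_cases h : c.Holds (e.eval s) (f.eval s) <;> simp [Spec, Cmd.Ok, Cmd.run, h, and_assoc]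

theorem spec_when {c : Comparison} {e f : ArithExpr V A} :
    Spec W β (.when c e f P) s R ↔ e.Ok W s ∧ f.Ok W s ∧
      (c.Holds (e.eval s) (f.eval s) → Spec W β P s R) ∧
      (¬ c.Holds (e.eval s) (f.eval s) → R s) := by
  simp only [Cmd.when, spec_ite, spec_skip]

theorem Spec.mono (h : Spec W β P s R) (hR : ∀ s', P.AgreeOff s s' → R s' → R' s') :
    Spec W β P s R' :=
  ⟨h.1, hR _ (P.agreeOff_run s) h.2⟩

theorem Spec.loop {x n : V} (I : ℕ → State V A → Prop) (hn : s.reg n ≤ β n)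
    (hinit : I 0 (s.setReg x 0))
    (hstep : ∀ k s', k < s.reg n → (Cmd.loop x n P).AgreeOff s s' → s'.reg x = k → I k s' →
      Spec W β P s' fun s'' => I (k + 1) (s''.setReg x (k + 1)))
    (hexit : ∀ s', I (s.reg n) s' → R s')
    (hwf : x ≠ n ∧ x ∉ P.regs ∧ n ∉ P.regs := by decide) : Spec W β (.loop x n P) s R := by
  have hagree (k : ℕ) := Cmd.agreeOff_loop_iter (n := n) P.agreeOff_run s k (x := x)
  have hinv : ∀ k ≤ s.reg n, I k (Cmd.iter x P.run s k) := by
    intro k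
    induction k with
    | zero => exact fun _ => hinit
    | succ k ih =>
      exact fun hk => (hstep k _ hk (hagree k) (Cmd.iter_reg_self ..) (ih (by omega))).2
  refine ⟨⟨hwf, hn, fun k hk => ?_⟩, hexit _ (hinv _ le_rfl)⟩
  exact (hstep k _ hk (hagree k) (Cmd.iter_reg_self ..) (hinv k hk.le)).1

/-- Write the value of `e`, which may depend on `x`, into the cell `x` of the array `a` for
`x = 0, …, n - 1`. -/
def Cmd.tabulate (x n : V) (a : A) (e : ArithExpr V A) : Cmd V A := .loop x n (.put a (.var x) e)

theorem Spec.tabulate {x n : V} {a : A} {e : ArithExpr V A} (Φ : ℕ → ℕ → Prop)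
    (hn : s.reg n ≤ β n)
    (he : ∀ k s', k < s.reg n → (Cmd.tabulate x n a e).AgreeOff s s' → s'.reg x = k →
      (∀ j < k, Φ j (s'.arr a j)) → s'.arr a k = s.arr a k → e.Ok W s' ∧ Φ k (e.eval s'))
    (hexit : ∀ s', (∀ j < s.reg n, Φ j (s'.arr a j)) → R s') (hxn : x ≠ n := by decide) :
    Spec W β (.tabulate x n a e) s R := by
  refine Spec.loop
    (fun k s' => (∀ j < k, Φ j (s'.arr a j)) ∧ ∀ j, k ≤ j → s'.arr a j = s.arr a j) hn
    ⟨by simp, fun _ _ => rfl⟩ ?_ (fun s' hs' => hexit s' hs'.1)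
    ⟨hxn, List.not_mem_nil, List.not_mem_nil⟩
  intro k s' hk hs hx ⟨hcells, hrest⟩
  obtain ⟨hok, hΦ⟩ := he k s' hk hs hx hcells (hrest k le_rfl)
  simp only [spec_put, ArithExpr.eval_var, hx, State.setReg_arr, State.setArr_arr, if_pos,
    Function.update_apply]
  refine ⟨trivial, hok, fun j hj => ?_, fun j hj => ?_⟩
  · split_ifs with hjk
    · rwa [hjk]
    · exact hcells j (by omega)
  · rw [if_neg (by omega)]
    exact hrest j (by omega)

end

/-! ### The variables of the algorithm and the loaded automaton -/

/-- The variables of the algorithm. The first three hold the input. -/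
inductive Var
  | N | p | start | base | lim | size | i | q | d | n | found | count | digit | first | second
  | m | r | head | tail | vertex | residue | bit | mismatch | next | ok
  deriving DecidableEq

/-- The arrays of the algorithm. The first two hold the input. -/
inductive Arr
  | delta | acc | reach | new | run | bits | seen | queue
  deriving DecidableEq

/-- A bound for the number of rounds of a loop up to the given variable, for an automaton with `N`
states over `b = 2 ^ p` digits. The variables with bound `0` do not occur as limits of loops. -/
def loopBound (b p N : ℕ) : Var → ℕ
  | .N => N
  | .p => p
  | .base => b
  | .lim => 4 * (b * N)
  | .size => 3 * (b * N ^ 2)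
  | _ => 0

/-- Words holding the numbers up to `W` suffice for the algorithm. -/
structure WordSize (b N W : ℕ) : Prop where
  two_le : 2 ≤ b
  pos : 1 ≤ N
  le : 4 * (b ^ 2 * N ^ 2) ≤ W

namespace WordSize

variable {b N W : ℕ}

theorem four_mul_le (h : WordSize b N W) : 4 * (b * N) ≤ W := by
  refine le_trans ?_ h.le
  rw [← mul_pow]
  exact Nat.mul_le_mul_left _ (Nat.le_self_pow (by norm_num) _)

theorem four_mul_base_le (h : WordSize b N W) : 4 * b ≤ W :=
  (Nat.mul_le_mul_left _ (Nat.le_mul_of_pos_right _ h.pos)).trans h.four_mul_le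

theorem four_mul_card_le (h : WordSize b N W) : 4 * N ≤ W := by
  have := h.two_le
  exact (Nat.mul_le_mul_left _ (Nat.le_mul_of_pos_left _ (by omega))).trans h.four_mul_le

end WordSize

/-- The variables and arrays that describe the automaton have their intended values. -/
structure Loaded {b N : ℕ} (A : DFA (Fin b) (Fin N)) (s : State Var Arr) : Prop where
  card : s.reg .N = N
  base : s.reg .base = b
  start : s.reg .start = A.start
  delta (q : Fin N) (d : Fin b) : s.arr .delta (q * b + d) = A.step q d

/-- The state reached from the state `x` by reading the digit `y`. -/
def transition (x y : Var) : ArithExpr Var Arr := .get .delta (.var x * .var .base + .var y)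

/-- The indices of the cells of the array `a` that hold `1`. -/
def marked (s : State Var Arr) (a : Arr) (N : ℕ) : Set (Fin N) := {q | s.arr a q = 1}

section

variable {b N W : ℕ} {A : DFA (Fin b) (Fin N)} {s s' : State Var Arr}

theorem Loaded.of_agreeOff {P : Cmd Var Arr} (h : Loaded A s) (hs : P.AgreeOff s s')
    (hregs : .N ∉ P.regs ∧ .base ∉ P.regs ∧ .start ∉ P.regs := by decide)
    (harrs : .delta ∉ P.arrs := by decide) : Loaded A s' where
  card := (hs.reg _ hregs.1).trans h.card
  base := (hs.reg _ hregs.2.1).trans h.base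
  start := (hs.reg _ hregs.2.2).trans h.start
  delta q d := (congrFun (hs.arr _ harrs) _).trans (h.delta q d)

theorem Loaded.eval_transition (h : Loaded A s) {x y : Var} {q : Fin N} {d : Fin b}
    (hq : s.reg x = q) (hd : s.reg y = d) : (transition x y).eval s = A.step q d := by
  simp [transition, hq, hd, h.base, h.delta]

theorem Loaded.ok_transition (h : Loaded A s) (hW : WordSize b N W) {x y : Var}
    {q : Fin N} {d : Fin b} (hq : s.reg x = q) (hd : s.reg y = d) : (transition x y).Ok W s := by
  have := mul_add_lt_mul q.2 d.2
  have := hW.four_mul_le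
  rw [mul_comm b] at this
  simp only [transition, ArithExpr.ok_get, ArithExpr.ok_add, ArithExpr.ok_mul, ArithExpr.ok_var,
    ArithExpr.eval_mul, ArithExpr.eval_var, hq, hd, h.base, true_and]
  omega

theorem mem_marked {a : Arr} {q : Fin N} : q ∈ marked s a N ↔ s.arr a q = 1 := Iff.rfl

theorem marked_setReg {a : Arr} {x : Var} {v : ℕ} :
    marked (s.setReg x v) a N = marked s a N := rfl

theorem marked_setArr_one {a : Arr} (q : Fin N) :
    marked (s.setArr a q 1) a N = insert q (marked s a N) := by
  ext q'
  by_cases h : q' = q <;> simp [marked, Function.update_apply, Fin.val_inj, h]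

end

/-- Computes the base from its logarithm `p`. -/
def computeBase : Cmd Var Arr :=
  .assign .base (.lit 1) ;; .loop .i .p (.assign .base (.var .base + .var .base))

theorem spec_computeBase {b p N W : ℕ} {s : State Var Arr} (hW : 2 ^ p ≤ W) (hp : s.reg .p = p) :
    Spec W (loopBound b p N) computeBase s (·.reg .base = 2 ^ p) := by
  rw [computeBase, spec_seq, spec_assign]
  refine ⟨Nat.one_le_two_pow.trans hW, Spec.loop (fun k s => s.reg .base = 2 ^ k) ?_ ?_ ?_ ?_⟩
  · simp [hp, loopBound]
  · simp
  · intro k s' hk _ _ hbase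
    have hk : k + 1 ≤ p := by simpa [hp] using hk
    have hdouble : 2 ^ k + 2 ^ k ≤ W := by
      rw [← two_mul, ← pow_succ']
      exact (Nat.pow_le_pow_right two_pos hk).trans hW
    simp [spec_assign, hbase, hdouble, pow_succ, mul_two]
  · simp [hp]

/-! ### Marking the reachable states -/

theorem exists_eval_eq_length_le_card {α σ : Type*} [Fintype σ] (A : DFA α σ) (w : List α) :
    ∃ v : List α, v.length ≤ Fintype.card σ ∧ A.eval v = A.eval w := by
  induction h : w.length using Nat.strong_induction_on generalizing w with
  | _ n ih =>
    by_cases hn : w.length ≤ Fintype.card σ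
    · exact ⟨w, hn, rfl⟩
    · obtain ⟨q, x, y, z, rfl, -, hy, hqx, -, hqz⟩ :=
        A.evalFrom_split (x := w) (s := A.start) (by omega) rfl
      have hlen : (x ++ z).length < n := by
        have := List.length_pos_iff.2 hy
        simp only [← h, List.length_append]
        omega
      obtain ⟨v, hv, heval⟩ := ih _ hlen (x ++ z) rfl
      exact ⟨v, hv, heval.trans (by rw [DFA.eval, DFA.evalFrom_of_append, hqx, hqz])⟩

theorem setOf_val_lt_succ {n : ℕ} (k : Fin n) :
    {i : Fin n | (i : ℕ) < k + 1} = insert k {i : Fin n | (i : ℕ) < k} := by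
  ext i
  simp only [Set.mem_ofPred_eq, Set.mem_insert_iff, Fin.ext_iff]
  omega

/-- Marks the successors of the state `q`. -/
def markSuccessors : Cmd Var Arr := .loop .d .base (.put .reach (transition .q .d) (.lit 1))

/-- Marks the successors of all marked states. -/
def markRound : Cmd Var Arr :=
  .loop .q .N (.when .eq (.get .reach (.var .q)) (.lit 1) markSuccessors)

/-- Marks the reachable states. -/
def markReachable : Cmd Var Arr := .put .reach (.var .start) (.lit 1) ;; .loop .i .N markRound

section

variable {b p N W : ℕ} {A : DFA (Fin b) (Fin N)} {s : State Var Arr}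

theorem spec_markSuccessors (hW : WordSize b N W) (hA : Loaded A s) {q : Fin N}
    (hq : s.reg .q = q) : Spec W (loopBound b p N) markSuccessors s fun s' =>
      marked s' .reach N = marked s .reach N ∪ Set.range (A.step q) := by
  refine Spec.loop (fun k s' => marked s' .reach N =
    marked s .reach N ∪ A.step q '' {d | d < k}) hA.base.le ?_ ?_ ?_
  · simp [marked_setReg]
  · intro k s' hk hs hd hmarked
    lift k to Fin b using hA.base ▸ hk
    have hq' : s'.reg .q = q := (hs.reg _ (by decide)).trans hq
    have hA' := hA.of_agreeOff hs
    rw [spec_put, hA'.eval_transition hq' hd]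
    refine ⟨hA'.ok_transition hW hq' hd, ?_, ?_⟩
    · have := hW.four_mul_base_le; have := hW.two_le; simp; omega
    · rw [marked_setReg, ArithExpr.eval_lit, marked_setArr_one, hmarked, setOf_val_lt_succ,
        Set.image_insert_eq, Set.union_insert]
  · intro s' hmarked
    simpa [hA.base] using hmarked

theorem spec_markRound (hW : WordSize b N W) (hA : Loaded A s) {R : Set (Fin N)}
    (hR : ∀ q ∈ R, ∀ d, A.step q d ∈ R) (hs : marked s .reach N ⊆ R) :
    Spec W (loopBound b p N) markRound s fun s' => marked s .reach N ⊆ marked s' .reach N ∧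
      (∀ q ∈ marked s .reach N, ∀ d, A.step q d ∈ marked s' .reach N) ∧
      marked s' .reach N ⊆ R := by
  refine Spec.loop (fun k s' => marked s .reach N ⊆ marked s' .reach N ∧
    (∀ q ∈ marked s .reach N, q < k → ∀ d, A.step q d ∈ marked s' .reach N) ∧
    marked s' .reach N ⊆ R) hA.card.le ⟨subset_rfl, by simp, hs⟩ ?_ ?_
  · rintro k s' hk hs hq ⟨hmono, hsucc, hsub⟩
    lift k to Fin N using hA.card ▸ hk
    simp only [spec_when, Comparison.Holds, ArithExpr.eval_get, ArithExpr.eval_var,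
      ArithExpr.eval_lit, hq, ← mem_marked, ArithExpr.ok_get, ArithExpr.ok_var, ArithExpr.ok_lit,
      true_and]
    refine ⟨by have := hW.four_mul_card_le; have := hW.pos; omega, fun hmem => ?_, fun hmem => ?_⟩
    · refine (spec_markSuccessors hW (hA.of_agreeOff hs) hq).mono fun s'' _ hs'' => ?_
      simp only [marked_setReg, hs'', Set.union_subset_iff]
      refine ⟨hmono.trans Set.subset_union_left, fun q hqs hqk d => ?_, hsub, ?_⟩
      · obtain hqk | hqk := (Nat.lt_succ_iff.1 hqk).lt_or_eq
        · exact Or.inl (hsucc q hqs hqk d)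
        · exact Or.inr ⟨d, by rw [Fin.ext hqk]⟩
      · exact Set.range_subset_iff.2 (hR _ (hsub hmem))
    · refine ⟨hmono, fun q hqs hqk d => ?_, hsub⟩
      obtain hqk | hqk := (Nat.lt_succ_iff.1 hqk).lt_or_eq
      · exact hsucc q hqs hqk d
      · exact absurd (Fin.ext hqk ▸ hmono hqs) hmem
  · rintro s' ⟨hmono, hsucc, hsub⟩
    exact ⟨hmono, fun q hq => hsucc q hq (hA.card.symm ▸ q.2), hsub⟩

theorem spec_markReachable (hW : WordSize b N W) (hA : Loaded A s)
    (hreach : marked s .reach N = ∅) : Spec W (loopBound b p N) markReachable s fun s' =>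
      marked s' .reach N = Set.range A.eval := by
  rw [markReachable, spec_seq, spec_put]
  refine ⟨trivial, by have := hW.four_mul_card_le; have := hW.pos; simp; omega, ?_⟩
  have hA' :
      Loaded A (s.setArr .reach ((ArithExpr.var .start).eval s) ((ArithExpr.lit 1).eval s)) :=
    hA.of_agreeOff (Cmd.agreeOff_run (.put .reach (.var .start) (.lit 1)) s)
  refine Spec.loop (fun k s' => A.eval '' {w | w.length ≤ k} ⊆ marked s' .reach N ∧
    marked s' .reach N ⊆ Set.range A.eval) hA'.card.le ?_ ?_ ?_
  · simp only [marked_setReg, ArithExpr.eval_var, ArithExpr.eval_lit, hA.start, marked_setArr_one,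
      hreach]
    simpa [DFA.eval] using ⟨[], rfl⟩
  · rintro k s' - hs - ⟨hmono, hsub⟩
    refine (spec_markRound hW (hA'.of_agreeOff hs) ?_ hsub).mono fun s'' _ ⟨hs'', hsucc, hsub⟩ =>
      ⟨?_, hsub⟩
    · rintro _ ⟨w, rfl⟩ d
      exact ⟨w ++ [d], A.eval_append_singleton w d⟩
    · rintro _ ⟨w, hw, rfl⟩
      obtain rfl | ⟨v, d, rfl⟩ := w.eq_nil_or_concat'
      · exact hs'' (hmono ⟨[], by simp, rfl⟩)
      · rw [A.eval_append_singleton]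
        exact hsucc _ (hmono ⟨v, by simpa using hw, rfl⟩) d
  · rintro s' ⟨hmono, hsub⟩
    refine hsub.antisymm ?_
    rintro _ ⟨w, rfl⟩
    obtain ⟨v, hv, heval⟩ := exists_eval_eq_length_le_card A w
    exact hmono ⟨v, by simpa [hA.card] using hv, heval⟩

end

/-! ### Stripping common last digits from the recognized set -/

theorem RecognizesWith.lastDigits_eq {b : ℕ} {σ : Type*} {A : DFA (Fin b) σ} {F : Set σ}
    {Y : Set ℕ} (hb : 1 < b) (h : RecognizesWith A F Y) :
    lastDigits b Y = Fin.val '' {d : Fin b | ∃ q ∈ Set.range A.eval, A.step q d ∈ F} := by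
  have hiff (w : List (Fin b)) (d : Fin b) : A.step (A.eval w) d ∈ F ↔ wordVal w * b + d ∈ Y := by
    rw [← A.eval_append_singleton, h, wordVal_append_singleton]
  ext d
  constructor
  · rintro ⟨y, hy, rfl⟩
    obtain ⟨w, hw⟩ := exists_word hb (y / b)
    refine ⟨⟨y % b, Nat.mod_lt _ (by omega)⟩, ⟨_, ⟨w, rfl⟩, ?_⟩, rfl⟩
    rwa [hiff, hw, Nat.div_add_mod']
  · rintro ⟨d, ⟨_, ⟨w, rfl⟩, hd⟩, rfl⟩
    exact ⟨_, (hiff w d).1 hd, by simp [Nat.mod_eq_of_lt d.2]⟩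

/-- The digits that lead from marked states to accepting ones. -/
def liveDigits {b N : ℕ} (A : DFA (Fin b) (Fin N)) (s : State Var Arr) : Set (Fin b) :=
  {d | ∃ q ∈ marked s .reach N, A.step q d ∈ marked s .acc N}

/-- Decides whether the digit `d` is live. -/
def testDigit : Cmd Var Arr :=
  .assign .found (.lit 0) ;;
  .loop .q .N (.when .eq (.get .reach (.var .q)) (.lit 1)
    (.when .eq (.get .acc (transition .q .d)) (.lit 1) (.assign .found (.lit 1))))

/-- Computes the number `count` of live digits and the largest live digit `digit`. -/
def findDigit : Cmd Var Arr :=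
  .assign .count (.lit 0) ;;
  .loop .d .base (testDigit ;; .when .eq (.var .found) (.lit 1)
    (.assign .count (.var .count + .lit 1) ;; .assign .digit (.var .d)))

/-- Accepts those states that lead to an accepting one by the digit `digit`. -/
def shiftAccept : Cmd Var Arr :=
  .tabulate .q .N .new (.get .acc (transition .q .digit)) ;;
  .tabulate .q .N .acc (.get .new (.var .q))

/-- Strips common last digits as often as there are states. -/
def stripDigits : Cmd Var Arr :=
  .loop .i .N (findDigit ;; .when .eq (.var .count) (.lit 1) shiftAccept)

section

variable {b p N W : ℕ} {A : DFA (Fin b) (Fin N)} {s : State Var Arr}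

theorem liveDigits_congr {s' : State Var Arr} (hreach : s'.arr .reach = s.arr .reach)
    (hacc : s'.arr .acc = s.arr .acc) : liveDigits A s' = liveDigits A s := by
  simp only [liveDigits, marked, hreach, hacc]

theorem spec_testDigit (hW : WordSize b N W) (hA : Loaded A s) {d : Fin b} (hd : s.reg .d = d) :
    Spec W (loopBound b p N) testDigit s fun s' => s'.reg .found = 1 ↔ d ∈ liveDigits A s := by
  have hone : 1 ≤ W := by have := hW.four_mul_card_le; have := hW.pos; omega
  rw [testDigit, spec_seq, spec_assign]
  refine ⟨Nat.zero_le _, ?_⟩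
  have hA' := hA.of_agreeOff (Cmd.agreeOff_run (.assign .found (.lit 0)) s)
  refine Spec.loop (fun k s' => s'.reg .found = 1 ↔
    ({q ∈ marked s .reach N | A.step q d ∈ marked s .acc N} ∩ {q | (q : ℕ) < k}).Nonempty)
    hA'.card.le (by simp) ?_ ?_
  · intro k s' hk hs hq hfound
    lift k to Fin N using hA'.card ▸ hk
    have hd' : s'.reg .d = d := (hs.reg _ (by decide)).trans hd
    have hreach : s'.arr .reach = s.arr .reach := hs.arr _ (by decide)
    have hacc : s'.arr .acc = s.arr .acc := hs.arr _ (by decide)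
    have hA'' := hA'.of_agreeOff hs
    simp only [spec_when, spec_assign, Comparison.Holds, ArithExpr.eval_get, ArithExpr.eval_var,
      ArithExpr.eval_lit, ArithExpr.ok_get, ArithExpr.ok_var, ArithExpr.ok_lit,
      hA''.eval_transition hq hd', hA''.ok_transition hW hq hd', hq, hreach, hacc, hone,
      ← mem_marked, true_and, setOf_val_lt_succ]
    refine ⟨fun hk => ⟨fun hstep => ?_, fun hstep => ?_⟩, fun hk => ?_⟩
    · simp [Set.inter_insert_of_mem, hk, hstep]
    · simpa [Set.inter_insert_of_notMem, hstep] using hfound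
    · simpa [Set.inter_insert_of_notMem, hk] using hfound
  · intro s' hfound
    simpa [hA.card, Set.Nonempty, liveDigits] using hfound

theorem spec_findDigit (hW : WordSize b N W) (hA : Loaded A s) :
    Spec W (loopBound b p N) findDigit s fun s' =>
      (s'.reg .count = 1 → ∃ d : Fin b, s'.reg .digit = d ∧ liveDigits A s = {d}) ∧
      (s'.reg .count ≠ 1 → ∀ d, liveDigits A s ≠ {d}) := by
  have hbW := hW.four_mul_base_le
  have hb := hW.two_le
  rw [findDigit, spec_seq, spec_assign]
  refine ⟨Nat.zero_le _, ?_⟩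
  have hA' := hA.of_agreeOff (Cmd.agreeOff_run (.assign .count (.lit 0)) s)
  refine Spec.loop (fun k s' => s'.reg .count = (liveDigits A s ∩ {d | (d : ℕ) < k}).ncard ∧
    (0 < s'.reg .count → ∃ d ∈ liveDigits A s, s'.reg .digit = d)) hA'.base.le (by simp) ?_ ?_
  · rintro k s' hk hs hd ⟨hcount, hdigit⟩
    lift k to Fin b using hA'.base ▸ hk
    have hlive : liveDigits A s' = liveDigits A s :=
      liveDigits_congr (hs.arr _ (by decide)) (hs.arr _ (by decide))
    rw [spec_seq]
    refine (spec_testDigit hW (hA'.of_agreeOff hs) hd).mono fun s'' hs' hfound => ?_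
    rw [hlive] at hfound
    have hcount' : s''.reg .count = s'.reg .count := hs'.reg _ (by decide)
    have hdigit' : s''.reg .digit = s'.reg .digit := hs'.reg _ (by decide)
    have hle : s'.reg .count ≤ b := by
      simpa [hcount] using Set.ncard_le_card (liveDigits A s ∩ {d | (d : ℕ) < k})
    simp only [spec_when, spec_seq, spec_assign, Comparison.Holds, ArithExpr.ok_var,
      ArithExpr.ok_lit, ArithExpr.ok_add, ArithExpr.eval_var, ArithExpr.eval_lit,
      ArithExpr.eval_add, hfound, setOf_val_lt_succ, true_and]
    refine ⟨by omega, fun hk => ⟨⟨by omega, by omega⟩, ?_⟩, fun hk => ?_⟩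
    · rw [Set.inter_insert_of_mem hk, Set.ncard_insert_of_notMem (by simp)]
      simpa [hcount', hcount, (hs'.reg .d (by decide)).trans hd] using ⟨k, hk, rfl⟩
    · rw [Set.inter_insert_of_notMem hk]
      simp only [State.setReg_reg, reduceCtorEq, if_false, hcount', hdigit']
      exact ⟨hcount, hdigit⟩
  · rintro s' ⟨hcount, hdigit⟩
    replace hcount : s'.reg .count = (liveDigits A s).ncard := by simpa [hA.base] using hcount
    rw [hcount, Set.ncard_eq_one]
    refine ⟨?_, fun hne d hd => hne (by rw [hd, Set.ncard_singleton])⟩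
    rintro ⟨d, hd⟩
    obtain ⟨d', hd', hdigit⟩ := hdigit (by simp [hcount, hd])
    rw [hd, Set.mem_singleton_iff] at hd'
    exact ⟨d, hd' ▸ hdigit, hd⟩

theorem spec_shiftAccept (hW : WordSize b N W) (hA : Loaded A s) {d : Fin b}
    (hd : s.reg .digit = d) : Spec W (loopBound b p N) shiftAccept s fun s' =>
      marked s' .acc N = {q | A.step q d ∈ marked s .acc N} := by
  rw [shiftAccept, spec_seq]
  refine Spec.mono (R := fun s' => ∀ q : Fin N, s'.arr .new q = s.arr .acc (A.step q d))
    (Spec.tabulate (fun j v => v = s.arr .acc (s.arr .delta (j * b + d))) hA.card.le ?_ ?_) ?_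
  · intro k s' hk hs hq _ _
    lift k to Fin N using hA.card ▸ hk
    have hA' := hA.of_agreeOff hs
    have hd' : s'.reg .digit = d := (hs.reg _ (by decide)).trans hd
    rw [ArithExpr.ok_get, ArithExpr.eval_get, hA'.eval_transition hq hd', hA.delta,
      hs.arr .acc (by decide)]
    exact ⟨hA'.ok_transition hW hq hd', rfl⟩
  · intro s' hnew q
    rw [hnew q (hA.card ▸ q.2), hA.delta]
  · intro s' hs hnew
    have hA' := hA.of_agreeOff hs
    refine Spec.tabulate (fun j v => v = s'.arr .new j) hA'.card.le ?_ ?_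
    · intro k s'' _ hs' hq _ _
      simp [hq, hs'.arr .new (by decide)]
    · intro s'' hacc
      ext q
      rw [mem_marked, hacc q (hA'.card ▸ q.2), hnew]
      rfl

theorem spec_stripDigits (hW : WordSize b N W) (hA : Loaded A s)
    (hreach : marked s .reach N = Set.range A.eval) {Y : Set ℕ}
    (hY : RecognizesWith A (marked s .acc N) Y) :
    Spec W (loopBound b p N) stripDigits s fun s' =>
      RecognizesWith A (marked s' .acc N) ((stripDigit b)^[N] Y) := by
  refine Spec.loop (fun k s' => RecognizesWith A (marked s' .acc N) ((stripDigit b)^[k] Y))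
    hA.card.le hY ?_ fun s' hY' => hA.card ▸ hY'
  intro k s' _ hs _ hY'
  have hreach' : marked s' .reach N = Set.range A.eval := by
    simpa only [marked, hs.arr .reach (by decide)] using hreach
  have hlast : lastDigits b ((stripDigit b)^[k] Y) = Fin.val '' liveDigits A s' := by
    rw [hY'.lastDigits_eq hW.two_le, liveDigits, hreach']
  simp only [spec_seq, spec_when, ArithExpr.ok_var, ArithExpr.ok_lit, true_and]
  refine (spec_findDigit hW (hA.of_agreeOff hs)).mono fun s'' hs' ⟨huniq, hnuniq⟩ =>
    ⟨by have := hW.four_mul_card_le; have := hW.pos; omega, fun hcount => ?_, fun hcount => ?_⟩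
  · obtain ⟨d, hdigit, hd⟩ := huniq hcount
    refine (spec_shiftAccept hW ((hA.of_agreeOff hs).of_agreeOff hs') hdigit).mono
      fun s₃ _ hacc => ?_
    rw [hd, Set.image_singleton] at hlast
    rw [Function.iterate_succ_apply', stripDigit_of_lastDigits_eq d.2 hlast, marked_setReg, hacc,
      marked, hs'.arr .acc (by decide)]
    exact hY'.digitQuotient d
  · have hnot : ¬ ∃ d, lastDigits b ((stripDigit b)^[k] Y) = {d} := by
      rintro ⟨c, hc⟩
      rw [hlast] at hc
      obtain ⟨d, -, rfl⟩ : c ∈ Fin.val '' liveDigits A s' := hc ▸ rfl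
      rw [← Set.image_singleton] at hc
      exact hnuniq hcount d (Fin.val_injective.image_injective hc)
    rw [Function.iterate_succ_apply', stripDigit, if_neg hnot, marked_setReg, marked,
      hs'.arr .acc (by decide)]
    exact hY'

end

/-! ### Finding the candidate for `m` and `r` -/

/-- Computes the states reached by words with the values `0, …, lim - 1`. -/
def tabulateRuns : Cmd Var Arr :=
  .put .run (.lit 0) (.var .start) ;;
  .tabulate .n .lim .run (.get .delta
    (.get .run (.var .n / .var .base) * .var .base + .var .n % .var .base))

/-- Finds the two smallest numbers `first` and `second` below `lim` that are accepted. -/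
def findLeastTwo : Cmd Var Arr :=
  .assign .first (.lit 0) ;; .assign .second (.lit 0) ;;
  .loop .i .lim (.assign .n (.var .lim - .lit 1 - .var .i) ;;
    .when .eq (.get .acc (.get .run (.var .n))) (.lit 1)
      (.assign .second (.var .first) ;; .assign .first (.var .n)))

/-- Derives `m` and `r` from the two smallest accepted numbers. -/
def findCandidate : Cmd Var Arr :=
  .assign .lim (.lit 4 * (.var .base * .var .N)) ;; tabulateRuns ;; findLeastTwo ;;
  .assign .r (.var .first) ;; .assign .m ((.var .second - .var .first) / .lit 3)

/-- The two smallest elements of `Y` are `x` and `y`. -/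
structure IsLeastTwo (Y : Set ℕ) (x y : ℕ) : Prop where
  lt : x < y
  left_mem : x ∈ Y
  right_mem : y ∈ Y
  eq_of_lt : ∀ n ∈ Y, n < y → n = x

theorem isLeastTwo_thueMorseAffine {m r : ℕ} (h : r < m) :
    IsLeastTwo (thueMorseAffine m r) r (r + 3 * m) where
  lt := by omega
  left_mem := self_mem_thueMorseAffine h
  right_mem := add_three_mul_mem_thueMorseAffine h
  eq_of_lt _ := eq_of_mem_thueMorseAffine_of_lt

section

variable {b p N W : ℕ} {A : DFA (Fin b) (Fin N)} {s : State Var Arr}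

theorem spec_tabulateRuns (hW : WordSize b N W) (hA : Loaded A s)
    (hlim : s.reg .lim = 4 * (b * N)) :
    Spec W (loopBound b p N) tabulateRuns s fun s' =>
      ∀ n < 4 * (b * N), ∃ w, wordVal w = n ∧ s'.arr .run n = A.eval w := by
  have hNb := hW.four_mul_le
  have hb : 0 < b := by have := hW.two_le; omega
  rw [tabulateRuns, spec_seq, spec_put]
  refine ⟨Nat.zero_le _, trivial, ?_⟩
  have hA' : Loaded A (s.setArr .run 0 (s.reg .start)) :=
    hA.of_agreeOff (Cmd.agreeOff_run (.put .run (.lit 0) (.var .start)) s)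
  refine Spec.tabulate (fun n q => ∃ w, wordVal w = n ∧ q = A.eval w) hlim.le ?_
    (hlim ▸ fun _ => id)
  intro k s' hk hs hn hcells hrest
  replace hk : k < 4 * (b * N) := by simpa [hlim] using hk
  replace hs := hA'.of_agreeOff hs
  obtain ⟨w, hw, hrun⟩ : ∃ w, wordVal w = k / b ∧ s'.arr .run (k / b) = A.eval w := by
    obtain rfl | hpos := k.eq_zero_or_pos
    · exact ⟨[], by simp [wordVal_nil], by simp [hrest, hA.start]⟩
    · exact hcells _ (Nat.div_lt_self hpos hW.two_le)
  obtain ⟨d, hd⟩ : ∃ d : Fin b, (d : ℕ) = k % b := ⟨⟨k % b, Nat.mod_lt _ hb⟩, rfl⟩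
  have hcell := mul_add_lt_mul (A.eval w).2 d.2
  rw [mul_comm N] at hcell
  have hk' : k / b * b + k % b = k := Nat.div_add_mod' k b
  simp only [ArithExpr.ok_get, ArithExpr.ok_add, ArithExpr.ok_mul, ArithExpr.ok_div,
    ArithExpr.ok_mod, ArithExpr.ok_var, ArithExpr.eval_get, ArithExpr.eval_add,
    ArithExpr.eval_mul, ArithExpr.eval_div, ArithExpr.eval_mod, ArithExpr.eval_var, hn, hs.base,
    hrun, ← hd, true_and, hs.delta]
  refine ⟨by omega, w ++ [d], ?_, by rw [A.eval_append_singleton]⟩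
  rw [wordVal_append_singleton, hw, hd, hk']

theorem spec_findLeastTwo (hW : WordSize b N W) {Y : Set ℕ} (hlim : s.reg .lim = 4 * (b * N))
    (hY : ∀ n < 4 * (b * N), s.arr .acc (s.arr .run n) = 1 ↔ n ∈ Y) :
    Spec W (loopBound b p N) findLeastTwo s fun s' => s'.reg .second ≤ 4 * (b * N) ∧
      ∀ x y, IsLeastTwo Y x y → y < 4 * (b * N) → s'.reg .first = x ∧ s'.reg .second = y := by
  have hNb := hW.four_mul_le
  have hpos : 1 ≤ b * N := Nat.mul_pos (by have := hW.two_le; omega) hW.pos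
  rw [findLeastTwo, spec_seq, spec_assign, spec_seq, spec_assign]
  refine ⟨Nat.zero_le _, Nat.zero_le _, Spec.loop (fun k s' =>
    s'.reg .first ≤ 4 * (b * N) ∧ s'.reg .second ≤ 4 * (b * N) ∧
    ∀ x y, IsLeastTwo Y x y → y < 4 * (b * N) →
      (x < 4 * (b * N) - k → 4 * (b * N) - k ≤ y → s'.reg .first = y) ∧
      (4 * (b * N) - k ≤ x → s'.reg .first = x ∧ s'.reg .second = y)) ?_ ?_ ?_ ?_⟩
  · simpa [loopBound] using hlim.le
  · simp only [State.setReg_reg, reduceCtorEq, if_true, if_false]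
    exact ⟨Nat.zero_le _, Nat.zero_le _, fun x y hxy hy => by have := hxy.lt; omega⟩
  · rintro k s' hk hs hi ⟨hfirst, hsecond, hleast⟩
    simp only [State.setReg_reg, reduceCtorEq, if_false, hlim] at hk
    have hlim' : s'.reg .lim = 4 * (b * N) := by
      rw [hs.reg .lim (by decide)]
      simpa using hlim
    have hacc : s'.arr .acc = s.arr .acc := hs.arr _ (by decide)
    have hrun : s'.arr .run = s.arr .run := hs.arr _ (by decide)
    simp only [spec_seq, spec_assign, spec_when, ArithExpr.ok_sub, ArithExpr.ok_get,
      ArithExpr.ok_var, ArithExpr.ok_lit, ArithExpr.eval_sub, ArithExpr.eval_get,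
      ArithExpr.eval_var, ArithExpr.eval_lit, Comparison.Holds, State.setReg_reg,
      State.setReg_arr, reduceCtorEq, if_true, if_false, hi, hlim', hacc, hrun,
      hY _ (show 4 * (b * N) - 1 - k < 4 * (b * N) by omega), true_and, and_true]
    refine ⟨by omega, by omega, fun hmem => ⟨by omega, hfirst, fun x y hxy hy => ?_⟩,
      fun hmem => ⟨hfirst, hsecond, fun x y hxy hy => ?_⟩⟩
    · have := hxy.lt
      have := hxy.eq_of_lt _ hmem
      have := hleast x y hxy hy
      omega
    · have := hxy.lt
      have := hleast x y hxy hy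
      have : x ≠ 4 * (b * N) - 1 - k := fun h => hmem (h ▸ hxy.left_mem)
      have : y ≠ 4 * (b * N) - 1 - k := fun h => hmem (h ▸ hxy.right_mem)
      omega
  · rintro s' ⟨-, hsecond, hleast⟩
    refine ⟨hsecond, fun x y hxy hy => (hleast x y hxy hy).2 ?_⟩
    simp [hlim]

theorem spec_findCandidate (hW : WordSize b N W) (hA : Loaded A s) {Y : Set ℕ}
    (hY : RecognizesWith A (marked s .acc N) Y) :
    Spec W (loopBound b p N) findCandidate s fun s' => 3 * s'.reg .m ≤ 4 * (b * N) ∧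
      ∀ m r, r < m → m ≤ b * N → Y = thueMorseAffine m r → s'.reg .m = m ∧ s'.reg .r = r := by
  have hNb := hW.four_mul_le
  have hpos : 1 ≤ b * N := Nat.mul_pos (by have := hW.two_le; omega) hW.pos
  rw [findCandidate, spec_seq, spec_assign]
  refine ⟨by simp [hA.base, hA.card]; omega, ?_⟩
  have hA' : Loaded A (s.setReg .lim _) :=
    hA.of_agreeOff (Cmd.agreeOff_run (.assign .lim (.lit 4 * (.var .base * .var .N))) s)
  rw [spec_seq]
  refine (spec_tabulateRuns hW hA' (by simp [hA.base, hA.card])).mono fun s₁ hs₁ hrun => ?_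
  have hlim₁ : s₁.reg .lim = 4 * (b * N) := by
    rw [hs₁.reg .lim (by decide)]
    simp [hA.base, hA.card]
  have hacc : s₁.arr .acc = s.arr .acc := hs₁.arr _ (by decide)
  rw [spec_seq]
  refine (spec_findLeastTwo (Y := Y) hW hlim₁ ?_).mono fun s₂ _ ⟨_, hleast⟩ => ?_
  · intro n hn
    obtain ⟨w, rfl, hw⟩ := hrun n hn
    rw [hw, hacc, ← mem_marked, hY]
  · simp only [spec_seq, spec_assign, ArithExpr.ok_sub, ArithExpr.ok_div, ArithExpr.ok_var,
      ArithExpr.ok_lit, ArithExpr.eval_sub, ArithExpr.eval_div, ArithExpr.eval_var,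
      ArithExpr.eval_lit, State.setReg_reg, reduceCtorEq, if_true, if_false, true_and]
    refine ⟨by omega, by omega, ?_⟩
    rintro m r hr hm rfl
    obtain ⟨hfirst, hsecond⟩ := hleast _ _ (isLeastTwo_thueMorseAffine hr) (by omega)
    omega

end

/-! ### Worklists -/

/-- An array `queue` with `tail` entries and an array `seen` that marks these entries by `1`. -/
structure Worklist where
  queue : ℕ → ℕ
  seen : ℕ → ℕ
  tail : ℕ

namespace Worklist

/-- The numbers that are marked as seen. -/
def entries (l : Worklist) : Set ℕ := {v | l.seen v = 1}

/-- The numbers marked as seen are the entries of the queue, and these are distinct. -/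
def Valid (l : Worklist) : Prop := Set.BijOn l.queue (Set.Iio l.tail) l.entries

/-- Appends `v` to the queue unless it has been seen. -/
def enqueue (l : Worklist) (v : ℕ) : Worklist :=
  if l.seen v = 1 then l else
    ⟨Function.update l.queue l.tail v, Function.update l.seen v 1, l.tail + 1⟩

/-- The first `k` entries of the queue. -/
def processed (l : Worklist) (k : ℕ) : Set ℕ := l.queue '' {i | i < k ∧ i < l.tail}

/-- The queue of `l'` starts with the entries of the queue of `l`. -/
structure IsPrefix (l l' : Worklist) : Prop where
  tail_le : l.tail ≤ l'.tail
  eqOn : Set.EqOn l'.queue l.queue (Set.Iio l.tail)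

variable {l l' l'' : Worklist} {k n v : ℕ}

theorem valid_of_tail_eq_zero (htail : l.tail = 0) (hl : l.entries = ∅) : l.Valid := by
  rw [Valid, htail, hl, ← bot_eq_zero, Set.Iio_bot]
  exact Set.bijOn_empty _

theorem entries_enqueue : (l.enqueue v).entries = insert v l.entries := by
  rw [enqueue]
  split_ifs with hv
  · exact (Set.insert_eq_of_mem (show v ∈ l.entries from hv)).symm
  · ext u
    by_cases hu : u = v <;> simp [entries, hu]

theorem Valid.enqueue (h : l.Valid) : (l.enqueue v).Valid := by
  rw [Valid, entries_enqueue, Worklist.enqueue]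
  split_ifs with hv
  · rwa [Set.insert_eq_of_mem (show v ∈ l.entries from hv)]
  · have heq : Set.EqOn (Function.update l.queue l.tail v) l.queue (Set.Iio l.tail) :=
      fun i hi => Function.update_of_ne (ne_of_lt hi) ..
    have hins := (h.congr heq.symm).insert (a := l.tail) (by rwa [Function.update_self])
    rwa [Function.update_self, ← Order.Iio_succ_eq_insert] at hins

theorem IsPrefix.refl (l : Worklist) : l.IsPrefix l := ⟨le_rfl, Set.eqOn_refl _ _⟩

theorem IsPrefix.trans (h : l.IsPrefix l') (h' : l'.IsPrefix l'') : l.IsPrefix l'' :=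
  ⟨h.tail_le.trans h'.tail_le, (h'.eqOn.mono (Set.Iio_subset_Iio h.tail_le)).trans h.eqOn⟩

theorem isPrefix_enqueue (l : Worklist) (v : ℕ) : l.IsPrefix (l.enqueue v) := by
  rw [enqueue]
  split_ifs
  · exact .refl l
  · exact ⟨Nat.le_succ _, fun i hi => Function.update_of_ne (ne_of_lt hi) ..⟩

theorem Valid.tail_le (h : l.Valid) (hl : l.entries ⊆ Set.Iio n) : l.tail ≤ n := by
  simpa using Set.ncard_le_ncard_of_injOn _ (fun i hi => hl (h.mapsTo hi)) h.injOn

theorem processed_zero : l.processed 0 = ∅ := by simp [processed]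

theorem processed_of_tail_le (hk : l.tail ≤ k) : l.processed k = l.queue '' Set.Iio l.tail := by
  rw [processed]
  congr 1
  ext i
  simp only [Set.mem_ofPred_eq, Set.mem_Iio]
  omega

theorem Valid.processed_eq_entries (h : l.Valid) (hk : l.tail ≤ k) :
    l.processed k = l.entries := by
  rw [processed_of_tail_le hk, h.image_eq]

theorem processed_succ (h : l.IsPrefix l') (hk : k < l.tail) :
    l'.processed (k + 1) = insert (l.queue k) (l.processed k) := by
  have htail := h.tail_le
  have hsucc : {i | i < k + 1 ∧ i < l'.tail} = insert k {i | i < k ∧ i < l.tail} := by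
    ext i
    simp only [Set.mem_ofPred_eq, Set.mem_insert_iff]
    omega
  rw [processed, hsucc, Set.image_insert_eq, h.eqOn hk, processed,
    (h.eqOn.mono fun i hi => hi.2).image_eq]

/-- The valid worklist `l'` arises from `l` by appending the elements of `V` that are missing. -/
structure Extends (l l' : Worklist) (V : Set ℕ) : Prop where
  valid : l'.Valid
  isPrefix : l.IsPrefix l'
  entries_eq : l'.entries = l.entries ∪ V

theorem Valid.extends_empty (h : l.Valid) : l.Extends l ∅ := ⟨h, .refl l, (Set.union_empty _).symm⟩

theorem Extends.enqueue {V : Set ℕ} (h : l.Extends l' V) :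
    l.Extends (l'.enqueue v) (insert v V) where
  valid := h.valid.enqueue
  isPrefix := h.isPrefix.trans (isPrefix_enqueue _ _)
  entries_eq := by rw [entries_enqueue, h.entries_eq, Set.union_insert]

end Worklist

/-- The worklist that is stored in the variables and arrays of the algorithm. -/
def worklist (s : State Var Arr) : Worklist := ⟨s.arr .queue, s.arr .seen, s.reg .tail⟩

theorem worklist_setReg {s : State Var Arr} {x : Var} {v : ℕ} (hx : .tail ≠ x := by decide) :
    worklist (s.setReg x v) = worklist s := by
  simp [worklist, hx]

theorem worklist_of_agreeOff {s s' : State Var Arr} {P : Cmd Var Arr} (hs : P.AgreeOff s s')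
    (hreg : .tail ∉ P.regs := by decide) (harrs : .queue ∉ P.arrs ∧ .seen ∉ P.arrs := by decide) :
    worklist s' = worklist s := by
  simp only [worklist, hs.reg _ hreg, hs.arr _ harrs.1, hs.arr _ harrs.2]

/-! ### Comparing the automaton with a Thue-Morse affine set -/

/-- The pair of states of `A` and of an automaton for `m T + r` that are reached by the word `w`,
encoded as a number. The latter automaton remembers the remainder of `wordVal w` modulo `m` and the
Thue-Morse bit of the quotient. -/
def vertexCode {p N : ℕ} (A : DFA (Fin (2 ^ p)) (Fin N)) (m : ℕ) (w : List (Fin (2 ^ p))) : ℕ :=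
  (A.eval w * m + wordVal w % m) * 2 + thueMorseBit (wordVal w / m)

section

variable {p N m : ℕ} {A : DFA (Fin (2 ^ p)) (Fin N)}

theorem vertexCode_lt (hm : 0 < m) (w : List (Fin (2 ^ p))) : vertexCode A m w < N * m * 2 :=
  mul_add_lt_mul (mul_add_lt_mul (A.eval w).2 (Nat.mod_lt _ hm)) (thueMorseBit_lt_two _)

theorem vertexCode_nil : vertexCode A m [] = A.start * m * 2 := by
  simp [vertexCode, wordVal_nil, thueMorseBit_zero]

theorem vertexCode_mod_two (w : List (Fin (2 ^ p))) :
    vertexCode A m w % 2 = thueMorseBit (wordVal w / m) := by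
  rw [vertexCode, Nat.mul_add_mod_of_lt (thueMorseBit_lt_two _)]

theorem vertexCode_div_two (w : List (Fin (2 ^ p))) :
    vertexCode A m w / 2 = A.eval w * m + wordVal w % m :=
  mul_add_div_of_lt (thueMorseBit_lt_two _)

theorem vertexCode_div_two_mod (w : List (Fin (2 ^ p))) :
    vertexCode A m w / 2 % m = wordVal w % m := by
  rw [vertexCode_div_two, Nat.mul_add_mod', Nat.mod_mod]

theorem vertexCode_div_two_div (hm : 0 < m) (w : List (Fin (2 ^ p))) :
    vertexCode A m w / 2 / m = A.eval w := by
  rw [vertexCode_div_two, mul_add_div_of_lt (Nat.mod_lt _ hm)]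

theorem vertexCode_eq_iff (hm : 0 < m) {v w : List (Fin (2 ^ p))} :
    vertexCode A m v = vertexCode A m w ↔ A.eval v = A.eval w ∧ wordVal v % m = wordVal w % m ∧
      thueMorseBit (wordVal v / m) = thueMorseBit (wordVal w / m) := by
  refine ⟨fun h => ⟨Fin.ext ?_, ?_, ?_⟩, fun ⟨hq, hj, he⟩ => by simp only [vertexCode, hq, hj, he]⟩
  · rw [← vertexCode_div_two_div hm, h, vertexCode_div_two_div hm]
  · rw [← vertexCode_div_two_mod (A := A), h, vertexCode_div_two_mod]
  · rw [← vertexCode_mod_two (A := A), h, vertexCode_mod_two]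

theorem vertexCode_append_singleton (hm : 0 < m) (w : List (Fin (2 ^ p))) (d : Fin (2 ^ p)) :
    vertexCode A m (w ++ [d]) =
      (A.step (A.eval w) d * m + (wordVal w % m * 2 ^ p + d) % m) * 2 +
        (thueMorseBit (wordVal w / m) + thueMorseBit ((wordVal w % m * 2 ^ p + d) / m)) % 2 := by
  have hval : wordVal w * 2 ^ p + d =
      m * (wordVal w / m * 2 ^ p) + (wordVal w % m * 2 ^ p + d) := by
    conv_lhs => rw [← Nat.div_add_mod (wordVal w) m]
    ring
  have hlt : (wordVal w % m * 2 ^ p + d) / m < 2 ^ p :=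
    Nat.div_lt_of_lt_mul (mul_add_lt_mul (Nat.mod_lt _ hm) d.2)
  rw [vertexCode, wordVal_append_singleton, DFA.eval_append_singleton, hval, Nat.mul_add_mod,
    Nat.mul_add_div hm, thueMorseBit_mul_two_pow_add _ _ _ hlt]

theorem vertexCode_append_singleton_congr (hm : 0 < m) {v w : List (Fin (2 ^ p))}
    (h : vertexCode A m v = vertexCode A m w) (d : Fin (2 ^ p)) :
    vertexCode A m (v ++ [d]) = vertexCode A m (w ++ [d]) := by
  obtain ⟨hq, hj, he⟩ := (vertexCode_eq_iff hm).1 h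
  rw [vertexCode_append_singleton hm, hq, hj, he, ← vertexCode_append_singleton hm]

/-- The automaton with accepting states `F` treats the word `w` as `m T + r` demands. -/
def IsCorrectOn (A : DFA (Fin (2 ^ p)) (Fin N)) (F : Set (Fin N)) (m r : ℕ)
    (w : List (Fin (2 ^ p))) : Prop := A.eval w ∈ F ↔ wordVal w ∈ thueMorseAffine m r

theorem isCorrectOn_congr {F : Set (Fin N)} {r : ℕ} (hr : r < m) {v w : List (Fin (2 ^ p))}
    (h : vertexCode A m v = vertexCode A m w) :
    IsCorrectOn A F m r v ↔ IsCorrectOn A F m r w := by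
  obtain ⟨hq, hj, he⟩ := (vertexCode_eq_iff (by omega)).1 h
  rw [IsCorrectOn, IsCorrectOn, mem_thueMorseAffine_iff hr, mem_thueMorseAffine_iff hr, hq, hj, he]

theorem RecognizesWith.eq_thueMorseAffine_iff (hp : 1 ≤ p) {F : Set (Fin N)} {Y : Set ℕ}
    (hY : RecognizesWith A F Y) (r : ℕ) :
    Y = thueMorseAffine m r ↔ ∀ w, IsCorrectOn A F m r w := by
  refine ⟨by rintro rfl; exact hY, fun h => Set.ext fun n => ?_⟩
  obtain ⟨w, rfl⟩ := exists_word (Nat.one_lt_two_pow (by omega : p ≠ 0)) n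
  exact (hY w).symm.trans (h w)

/-- The first `k` vertices of the worklist `l` have been processed in the exploration of the
vertices that are reachable from the initial one. -/
structure Explored (A : DFA (Fin (2 ^ p)) (Fin N)) (m : ℕ) (l : Worklist) (k : ℕ) : Prop where
  valid : l.Valid
  subset : l.entries ⊆ Set.range (vertexCode A m)
  nil_mem : vertexCode A m [] ∈ l.entries
  append_mem (w : List (Fin (2 ^ p))) (hw : vertexCode A m w ∈ l.processed k) (d : Fin (2 ^ p)) :
    vertexCode A m (w ++ [d]) ∈ l.entries

namespace Explored

variable {l l' : Worklist} {k : ℕ}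

theorem tail_le (h : Explored A m l k) (hm : 0 < m) : l.tail ≤ N * m * 2 :=
  h.valid.tail_le (h.subset.trans (Set.range_subset_iff.2 (vertexCode_lt hm)))

theorem succ (h : Explored A m l k) (hm : 0 < m) (hk : k < l.tail) {w : List (Fin (2 ^ p))}
    (hw : l.queue k = vertexCode A m w)
    (hl' : l.Extends l' (Set.range fun d => vertexCode A m (w ++ [d]))) :
    Explored A m l' (k + 1) where
  valid := hl'.valid
  subset := by
    rw [hl'.entries_eq]
    exact Set.union_subset h.subset (Set.range_subset_iff.2 fun d => ⟨_, rfl⟩)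
  nil_mem := hl'.entries_eq ▸ Or.inl h.nil_mem
  append_mem v hv d := by
    rw [Worklist.processed_succ hl'.isPrefix hk, hw] at hv
    rw [hl'.entries_eq]
    obtain hv | hv := hv
    · exact Or.inr ⟨d, (vertexCode_append_singleton_congr hm hv d).symm⟩
    · exact Or.inl (h.append_mem v hv d)

theorem succ_of_tail_le (h : Explored A m l k) (hk : l.tail ≤ k) : Explored A m l (k + 1) where
  __ := h
  append_mem := by
    rw [Worklist.processed_of_tail_le (by omega), ← Worklist.processed_of_tail_le hk]
    exact h.append_mem

theorem mem_processed (h : Explored A m l k) (hm : 0 < m) (hk : N * m * 2 ≤ k)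
    (w : List (Fin (2 ^ p))) : vertexCode A m w ∈ l.processed k := by
  rw [h.valid.processed_eq_entries ((h.tail_le hm).trans hk)]
  induction w using List.reverseRecOn with
  | nil => exact h.nil_mem
  | append_singleton w d ih =>
    exact h.append_mem w ((h.valid.processed_eq_entries ((h.tail_le hm).trans hk)).symm ▸ ih) d

theorem initial (htail : l.tail = 0) (hl : l.entries = ∅) :
    Explored A m (l.enqueue (vertexCode A m [])) 0 where
  valid := (Worklist.valid_of_tail_eq_zero htail hl).enqueue
  subset := by simp [Worklist.entries_enqueue, hl]
  nil_mem := Worklist.entries_enqueue ▸ Set.mem_insert _ _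
  append_mem := by simp [Worklist.processed_zero]

end Explored

/-- The automaton with accepting states `F` is correct on the words that lead to one of the first
`k` vertices of the worklist. -/
def IsCorrectUpTo (A : DFA (Fin (2 ^ p)) (Fin N)) (F : Set (Fin N)) (m r : ℕ) (l : Worklist)
    (k : ℕ) : Prop := ∀ w, vertexCode A m w ∈ l.processed k → IsCorrectOn A F m r w

section

variable {l l' : Worklist} {F : Set (Fin N)} {r k : ℕ}

theorem isCorrectUpTo_zero : IsCorrectUpTo A F m r l 0 := by
  simp [IsCorrectUpTo, Worklist.processed_zero]

theorem isCorrectUpTo_succ (hr : r < m) (hl' : l.IsPrefix l') (hk : k < l.tail)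
    {w : List (Fin (2 ^ p))} (hw : l.queue k = vertexCode A m w) :
    IsCorrectUpTo A F m r l' (k + 1) ↔ IsCorrectUpTo A F m r l k ∧ IsCorrectOn A F m r w := by
  simp only [IsCorrectUpTo, Worklist.processed_succ hl' hk, hw, Set.mem_insert_iff, or_imp,
    forall_and]
  rw [and_comm]
  exact and_congr_right fun _ =>
    ⟨fun h => h w rfl, fun h v hv => (isCorrectOn_congr hr hv).2 h⟩

theorem isCorrectUpTo_succ_of_tail_le (hk : l.tail ≤ k) :
    IsCorrectUpTo A F m r l (k + 1) ↔ IsCorrectUpTo A F m r l k := by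
  rw [IsCorrectUpTo, IsCorrectUpTo, Worklist.processed_of_tail_le hk,
    Worklist.processed_of_tail_le (by omega)]

end

end

/-- Tabulates the Thue-Morse bits of the digits. -/
def computeBits : Cmd Var Arr :=
  .tabulate .d .base .bits ((.get .bits (.var .d / .lit 2) + .var .d) % .lit 2)

/-- Appends the vertex `next` to the queue unless it has been seen. -/
def enqueueNext : Cmd Var Arr :=
  .ite .eq (.get .seen (.var .next)) (.lit 1) .skip
    (.put .queue (.var .tail) (.var .next) ;; .put .seen (.var .next) (.lit 1) ;;
      .assign .tail (.var .tail + .lit 1))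

/-- Decodes the vertex at position `head` of the queue. -/
def decodeVertex : Cmd Var Arr :=
  .assign .vertex (.get .queue (.var .head)) ;;
  .assign .bit (.var .vertex % .lit 2) ;;
  .assign .residue (.var .vertex / .lit 2 % .var .m) ;;
  .assign .q (.var .vertex / .lit 2 / .var .m)

/-- Clears `ok` if the current vertex is accepted wrongly. -/
def testVertex : Cmd Var Arr :=
  .assign .mismatch (.lit 0) ;;
  .when .eq (.var .residue) (.var .r) (.when .eq (.var .bit) (.lit 0)
    (.assign .mismatch (.lit 1))) ;;
  .when .eq (.get .acc (.var .q)) (.lit 1) (.assign .mismatch (.lit 1 - .var .mismatch)) ;;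
  .when .eq (.var .mismatch) (.lit 1) (.assign .ok (.lit 0))

/-- Computes the successor of the current vertex by the digit `d`. -/
def computeSuccessor : Cmd Var Arr :=
  .assign .n (.var .residue * .var .base + .var .d) ;;
  .assign .next ((transition .q .d * .var .m + .var .n % .var .m) * .lit 2 +
    (.var .bit + .get .bits (.var .n / .var .m)) % .lit 2)

/-- Appends the successors of the current vertex. -/
def appendSuccessors : Cmd Var Arr := .loop .d .base (computeSuccessor ;; enqueueNext)

/-- Tests the vertex at position `head` of the queue and appends its successors. -/
def processVertex : Cmd Var Arr :=
  decodeVertex ;; testVertex ;; appendSuccessors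

/-- Starts an exploration at the initial vertex. -/
def initExploration : Cmd Var Arr :=
  .assign .ok (.lit 1) ;; .assign .size (.var .N * .var .m * .lit 2) ;;
  .assign .tail (.lit 0) ;; .assign .next (.var .start * .var .m * .lit 2) ;; enqueueNext

/-- Processes the vertex at position `head` of the queue if there is one. -/
def exploreRound : Cmd Var Arr := .when .lt (.var .head) (.var .tail) processVertex

/-- Explores all vertices that are reachable from the initial one. -/
def explore : Cmd Var Arr := initExploration ;; .loop .head .size exploreRound

/-- Decides in `ok` whether the automaton accepts `m T + r`. -/
def checkCandidate : Cmd Var Arr :=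
  .ite .lt (.var .r) (.var .m) explore (.assign .ok (.lit 0))

/-- The modulus `m` is positive and small enough for the numbers up to `W`. -/
structure ModulusSize (b N W m : ℕ) : Prop where
  pos : 0 < m
  mul_base_le : m * b ≤ W
  card_mul_lt : N * m * 2 < W
  card_mul_le : N * m * 2 ≤ 3 * (b * N ^ 2)

theorem WordSize.modulusSize {b N W m : ℕ} (hW : WordSize b N W) (hm : 0 < m)
    (hle : 3 * m ≤ 4 * (b * N)) : ModulusSize b N W m := by
  have hb := hW.two_le
  have hN := hW.pos
  have hW' := hW.le
  have hmb : 3 * (m * b) ≤ 4 * (b ^ 2 * N ^ 2) := calc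
    3 * (m * b) = 3 * m * b := by ring
    _ ≤ 4 * (b * N) * (b * N) := Nat.mul_le_mul hle (Nat.le_mul_of_pos_right _ hN)
    _ = _ := by ring
  have hmN : 3 * (N * m) ≤ 4 * (b * N ^ 2) := calc
    3 * (N * m) = N * (3 * m) := by ring
    _ ≤ N * (4 * (b * N)) := Nat.mul_le_mul_left _ hle
    _ = _ := by ring
  have hbb : 2 * (b * N ^ 2) ≤ b ^ 2 * N ^ 2 := by
    rw [pow_two b, mul_assoc]
    exact Nat.mul_le_mul_right _ hb
  have hpos : 0 < b * N ^ 2 := by positivity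
  constructor <;> omega

/-- The variables and arrays describe the automaton `A` with the accepting states `F`, the numbers
`m` and `r`, and the Thue-Morse bits of the digits. -/
structure Prepared {p N : ℕ} (A : DFA (Fin (2 ^ p)) (Fin N)) (F : Set (Fin N)) (m r : ℕ)
    (s : State Var Arr) : Prop extends Loaded A s where
  modulus : s.reg .m = m
  remainder : s.reg .r = r
  bits (d : ℕ) (hd : d < 2 ^ p) : s.arr .bits d = thueMorseBit d
  acc : marked s .acc N = F

/-- The variables describe the vertex that is encoded by `vertexCode A m w`. -/
structure Decoded {p N : ℕ} (A : DFA (Fin (2 ^ p)) (Fin N)) (m : ℕ) (w : List (Fin (2 ^ p)))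
    (s : State Var Arr) : Prop where
  state : s.reg .q = A.eval w
  residue : s.reg .residue = wordVal w % m
  bit : s.reg .bit = thueMorseBit (wordVal w / m)

section

variable {p N W m r : ℕ} {A : DFA (Fin (2 ^ p)) (Fin N)} {F : Set (Fin N)}
  {s s' : State Var Arr} {P : Cmd Var Arr} {w : List (Fin (2 ^ p))}

theorem Prepared.of_agreeOff (h : Prepared A F m r s) (hs : P.AgreeOff s s')
    (hregs : (.N ∉ P.regs ∧ .base ∉ P.regs ∧ .start ∉ P.regs) ∧ .m ∉ P.regs ∧ .r ∉ P.regs := by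
      decide)
    (harrs : .delta ∉ P.arrs ∧ .bits ∉ P.arrs ∧ .acc ∉ P.arrs := by decide) :
    Prepared A F m r s' where
  toLoaded := h.toLoaded.of_agreeOff hs hregs.1 harrs.1
  modulus := (hs.reg _ hregs.2.1).trans h.modulus
  remainder := (hs.reg _ hregs.2.2).trans h.remainder
  bits d hd := (congrFun (hs.arr _ harrs.2.1) d).trans (h.bits d hd)
  acc := by rw [← h.acc, marked, marked, hs.arr _ harrs.2.2]

theorem Decoded.of_agreeOff (h : Decoded A m w s) (hs : P.AgreeOff s s')
    (hregs : .q ∉ P.regs ∧ .residue ∉ P.regs ∧ .bit ∉ P.regs := by decide) : Decoded A m w s' where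
  state := (hs.reg _ hregs.1).trans h.state
  residue := (hs.reg _ hregs.2.1).trans h.residue
  bit := (hs.reg _ hregs.2.2).trans h.bit

theorem spec_computeBits (hW : WordSize (2 ^ p) N W) (hA : Loaded A s)
    (hbits : s.arr .bits 0 = 0) :
    Spec W (loopBound (2 ^ p) p N) computeBits s fun s' =>
      ∀ d < 2 ^ p, s'.arr .bits d = thueMorseBit d := by
  have hbW := hW.four_mul_base_le
  refine Spec.tabulate (fun d v => v = thueMorseBit d) hA.base.le ?_ (hA.base ▸ fun _ => id)
  intro k s' hk hs hd hcells hrest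
  rw [hA.base] at hk
  have hhalf : s'.arr .bits (k / 2) = thueMorseBit (k / 2) := by
    obtain rfl | hpos := k.eq_zero_or_pos
    · rw [Nat.zero_div, hrest, hbits, thueMorseBit_zero]
    · exact hcells _ (by omega)
  have hlt := thueMorseBit_lt_two (k / 2)
  simp only [ArithExpr.ok_mod, ArithExpr.ok_add, ArithExpr.ok_get, ArithExpr.ok_div,
    ArithExpr.ok_var, ArithExpr.ok_lit, ArithExpr.eval_mod, ArithExpr.eval_add,
    ArithExpr.eval_get, ArithExpr.eval_div, ArithExpr.eval_var, ArithExpr.eval_lit, hd, hhalf,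
    ← thueMorseBit_eq_half, and_true, true_and]
  omega

theorem spec_enqueueNext {β : Var → ℕ} (htail : s.reg .tail < W) :
    Spec W β enqueueNext s fun s' => worklist s' = (worklist s).enqueue (s.reg .next) := by
  simp only [enqueueNext, spec_ite, spec_skip, spec_seq, spec_put, spec_assign, Comparison.Holds,
    ArithExpr.ok_get, ArithExpr.ok_add, ArithExpr.ok_var, ArithExpr.ok_lit, ArithExpr.eval_get,
    ArithExpr.eval_add, ArithExpr.eval_var, ArithExpr.eval_lit, State.setArr_reg, true_and]
  refine ⟨by omega, fun hseen => ?_, fun hseen => ⟨by omega, ⟨by omega, by omega⟩, ?_⟩⟩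
  · rw [Worklist.enqueue, if_pos (by exact hseen)]
  · rw [Worklist.enqueue, if_neg (by exact hseen)]
    simp [worklist]

theorem spec_decodeVertex (hW : WordSize (2 ^ p) N W) (hm : ModulusSize (2 ^ p) N W m)
    (hs : Prepared A F m r s) (hv : s.arr .queue (s.reg .head) = vertexCode A m w) :
    Spec W (loopBound (2 ^ p) p N) decodeVertex s (Decoded A m w) := by
  have hbW := hW.four_mul_base_le
  have hb := hW.two_le
  have hlt := (vertexCode_lt (A := A) hm.pos w).trans hm.card_mul_lt
  have hdiv := Nat.div_mul_le_self (vertexCode A m w) 2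
  have hmul := Nat.div_mul_le_self (vertexCode A m w / 2) m
  simp only [decodeVertex, spec_seq, spec_assign, ArithExpr.ok_get, ArithExpr.ok_mod,
    ArithExpr.ok_div, ArithExpr.ok_var, ArithExpr.ok_lit, ArithExpr.eval_get, ArithExpr.eval_mod,
    ArithExpr.eval_div, ArithExpr.eval_var, ArithExpr.eval_lit, State.setReg_reg, reduceCtorEq,
    if_true, if_false, hv, hs.modulus, true_and, and_true]
  refine ⟨by omega, by omega, by omega, ?_⟩
  constructor <;> simp [vertexCode_div_two_div hm.pos, vertexCode_div_two_mod, vertexCode_mod_two]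

theorem spec_testVertex (hW : 1 ≤ W) {β : Var → ℕ} (hr : r < m) (hs : Prepared A F m r s)
    (hw : Decoded A m w s) : Spec W β testVertex s fun s' =>
      s'.reg .ok = 1 ↔ s.reg .ok = 1 ∧ IsCorrectOn A F m r w := by
  have hmem := mem_thueMorseAffine_iff hr (wordVal w)
  rw [IsCorrectOn, ← hs.acc]
  simp only [testVertex, spec_seq, spec_when, spec_assign, Comparison.Holds, ArithExpr.ok_get,
    ArithExpr.ok_sub, ArithExpr.ok_var, ArithExpr.ok_lit, ArithExpr.eval_get, ArithExpr.eval_sub,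
    ArithExpr.eval_var, ArithExpr.eval_lit, State.setReg_reg, State.setReg_arr, reduceCtorEq,
    if_true, if_false, hw.state, hw.residue, hw.bit, hs.remainder, mem_marked, hmem, hW, true_and]
  by_cases hres : wordVal w % m = r <;> by_cases hbit : thueMorseBit (wordVal w / m) = 0 <;>
    by_cases hacc : s.arr .acc (A.eval w) = 1 <;> simp [hres, hbit, hacc]

theorem spec_computeSuccessor (hW : WordSize (2 ^ p) N W) (hm : ModulusSize (2 ^ p) N W m)
    (hs : Prepared A F m r s) (hw : Decoded A m w s) {d : Fin (2 ^ p)} (hd : s.reg .d = d) :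
    Spec W (loopBound (2 ^ p) p N) computeSuccessor s
      (·.reg .next = vertexCode A m (w ++ [d])) := by
  have hbW := hW.four_mul_base_le
  have hb := hW.two_le
  have hmb := hm.mul_base_le
  have hn : wordVal w % m * 2 ^ p + d < m * 2 ^ p := mul_add_lt_mul (Nat.mod_lt _ hm.pos) d.2
  have hdiv := Nat.div_mul_le_self (wordVal w % m * 2 ^ p + d) m
  have hbit := thueMorseBit_lt_two (wordVal w / m)
  have hbit' := thueMorseBit_lt_two ((wordVal w % m * 2 ^ p + d) / m)
  have hcode := (vertexCode_lt (A := A) hm.pos (w ++ [d])).trans hm.card_mul_lt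
  rw [vertexCode_append_singleton hm.pos] at hcode ⊢
  have hA' : Loaded A (s.setReg .n (wordVal w % m * 2 ^ p + d)) :=
    ⟨hs.card, hs.base, hs.start, hs.delta⟩
  have heval := hA'.eval_transition (x := .q) (y := .d) hw.state hd
  have hok := hA'.ok_transition hW (x := .q) (y := .d) hw.state hd
  simp only [computeSuccessor, spec_seq, spec_assign, ArithExpr.ok_get, ArithExpr.ok_mod,
    ArithExpr.ok_div, ArithExpr.ok_mul, ArithExpr.ok_add, ArithExpr.ok_var, ArithExpr.ok_lit,
    ArithExpr.eval_get, ArithExpr.eval_mod, ArithExpr.eval_mul, ArithExpr.eval_add,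
    ArithExpr.eval_div, ArithExpr.eval_var, ArithExpr.eval_lit, State.setReg_reg,
    State.setReg_arr, reduceCtorEq, if_true, if_false, hs.modulus, hw.residue, hw.bit, hd, hs.base,
    heval, hok, hs.bits _ (Nat.div_lt_of_lt_mul hn), true_and, and_true]
  omega

theorem spec_appendSuccessors (hW : WordSize (2 ^ p) N W) (hm : ModulusSize (2 ^ p) N W m)
    (hs : Prepared A F m r s) (hvalid : (worklist s).Valid)
    (hsub : (worklist s).entries ⊆ Set.range (vertexCode A m)) (hw : Decoded A m w s) :
    Spec W (loopBound (2 ^ p) p N) appendSuccessors s fun s' =>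
      (worklist s).Extends (worklist s') (Set.range fun d => vertexCode A m (w ++ [d])) := by
  refine Spec.loop (fun k s' => (worklist s).Extends (worklist s')
    ((fun d => vertexCode A m (w ++ [d])) '' {d : Fin (2 ^ p) | d < k})) hs.base.le ?_ ?_ ?_
  · simpa [worklist_setReg] using hvalid.extends_empty
  · intro k s' hk hs' hd hext
    lift k to Fin (2 ^ p) using hs.base ▸ hk
    have htail : (worklist s').tail < W := by
      refine (hext.valid.tail_le (n := N * m * 2) ?_).trans_lt hm.card_mul_lt
      rw [hext.entries_eq]
      exact Set.union_subset (hsub.trans (Set.range_subset_iff.2 (vertexCode_lt hm.pos)))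
        (Set.image_subset_iff.2 fun d _ => vertexCode_lt hm.pos _)
    refine spec_seq.2 ((spec_computeSuccessor hW hm (hs.of_agreeOff hs') (hw.of_agreeOff hs')
      hd).mono fun s₁ hs₁ hnext => ?_)
    rw [← worklist_of_agreeOff hs₁] at htail hext
    refine (spec_enqueueNext htail).mono fun s₂ _ hs₂ => ?_
    rw [worklist_setReg, hs₂, hnext, setOf_val_lt_succ, Set.image_insert_eq]
    exact hext.enqueue
  · intro s' hext
    simpa [hs.base] using hext

theorem spec_processVertex (hW : WordSize (2 ^ p) N W) (hm : ModulusSize (2 ^ p) N W m)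
    (hr : r < m) (hs : Prepared A F m r s) (hvalid : (worklist s).Valid)
    (hsub : (worklist s).entries ⊆ Set.range (vertexCode A m))
    (hv : s.arr .queue (s.reg .head) = vertexCode A m w) :
    Spec W (loopBound (2 ^ p) p N) processVertex s fun s' =>
      (worklist s).Extends (worklist s') (Set.range fun d => vertexCode A m (w ++ [d])) ∧
      (s'.reg .ok = 1 ↔ s.reg .ok = 1 ∧ IsCorrectOn A F m r w) := by
  have hbW := hW.four_mul_base_le
  have hb := hW.two_le
  refine spec_seq.2 ((spec_decodeVertex hW hm hs hv).mono fun s₁ hs₁ hw₁ =>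
    spec_seq.2 ((spec_testVertex (by omega) hr (hs.of_agreeOff hs₁) hw₁).mono
      fun s₂ hs₂ hok₂ => ?_))
  rw [hs₁.reg .ok (by decide)] at hok₂
  rw [← worklist_of_agreeOff hs₁, ← worklist_of_agreeOff hs₂] at hvalid hsub ⊢
  refine (spec_appendSuccessors hW hm ((hs.of_agreeOff hs₁).of_agreeOff hs₂) hvalid hsub
    (hw₁.of_agreeOff hs₂)).mono fun s₃ hs₃ hext => ⟨hext, ?_⟩
  rw [hs₃.reg .ok (by decide), hok₂]

theorem spec_initExploration {β : Var → ℕ} (hm : ModulusSize (2 ^ p) N W m)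
    (hs : Prepared A F m r s) (hseen : ∀ v, s.arr .seen v ≠ 1) :
    Spec W β initExploration s fun s' =>
      s'.reg .size = N * m * 2 ∧ s'.reg .ok = 1 ∧ Explored A m (worklist s') 0 := by
  have hlt := hm.card_mul_lt
  have hnil := vertexCode_lt (A := A) hm.pos []
  rw [vertexCode_nil] at hnil
  simp only [initExploration, spec_seq, spec_assign, ArithExpr.ok_mul, ArithExpr.ok_var,
    ArithExpr.ok_lit, ArithExpr.eval_mul, ArithExpr.eval_var, ArithExpr.eval_lit,
    State.setReg_reg, reduceCtorEq, if_false, hs.card, hs.modulus, hs.start, true_and]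
  refine ⟨by omega, by omega, by omega, by omega, (spec_enqueueNext ?_).mono fun s' hs' hl => ?_⟩
  · simp; omega
  · rw [hl, hs'.reg .size (by decide), hs'.reg .ok (by decide)]
    have hempty : {v | s.arr .seen v = 1} = ∅ := Set.eq_empty_iff_forall_notMem.2 hseen
    refine ⟨by simp, by simp, ?_⟩
    convert Explored.initial (A := A) (m := m) (l := ⟨s.arr .queue, s.arr .seen, 0⟩) rfl hempty
      using 1
    simp [worklist, vertexCode_nil]

theorem spec_exploreRound (hW : WordSize (2 ^ p) N W) (hm : ModulusSize (2 ^ p) N W m)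
    (hr : r < m) (hs : Prepared A F m r s) (hexp : Explored A m (worklist s) (s.reg .head))
    (hok : s.reg .ok = 1 ↔ IsCorrectUpTo A F m r (worklist s) (s.reg .head)) :
    Spec W (loopBound (2 ^ p) p N) exploreRound s fun s' =>
      Explored A m (worklist s') (s.reg .head + 1) ∧
      (s'.reg .ok = 1 ↔ IsCorrectUpTo A F m r (worklist s') (s.reg .head + 1)) := by
  simp only [exploreRound, spec_when, Comparison.Holds, ArithExpr.ok_var, ArithExpr.eval_var,
    true_and]
  refine ⟨fun hlt => ?_, fun hlt => ?_⟩
  · obtain ⟨w, hw⟩ := hexp.subset (hexp.valid.mapsTo hlt)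
    refine (spec_processVertex hW hm hr hs hexp.valid hexp.subset hw.symm).mono
      fun s' _ ⟨hext, hok'⟩ => ⟨hexp.succ hm.pos hlt hw.symm hext, ?_⟩
    rw [hok', hok, isCorrectUpTo_succ hr hext.isPrefix hlt hw.symm]
  · have htail : (worklist s).tail ≤ s.reg .head := not_lt.1 hlt
    exact ⟨hexp.succ_of_tail_le htail, hok.trans (isCorrectUpTo_succ_of_tail_le htail).symm⟩

theorem spec_exploreRounds (hp : 1 ≤ p) (hW : WordSize (2 ^ p) N W)
    (hm : ModulusSize (2 ^ p) N W m) (hr : r < m) (hs : Prepared A F m r s)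
    (hsize : s.reg .size = N * m * 2) (hexp : Explored A m (worklist s) 0) (hok : s.reg .ok = 1)
    {Y : Set ℕ} (hY : RecognizesWith A F Y) :
    Spec W (loopBound (2 ^ p) p N) (.loop .head .size exploreRound) s
      (·.reg .ok = 1 ↔ Y = thueMorseAffine m r) := by
  refine Spec.loop (fun k s' => Explored A m (worklist s') k ∧
    (s'.reg .ok = 1 ↔ IsCorrectUpTo A F m r (worklist s') k)) (hsize ▸ hm.card_mul_le) ?_ ?_ ?_
  · simpa [worklist_setReg, hok, isCorrectUpTo_zero] using hexp
  · rintro k s' - hs' rfl ⟨hexp', hok'⟩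
    refine (spec_exploreRound hW hm hr (hs.of_agreeOff hs') hexp' hok').mono fun s'' _ hs'' => ?_
    simpa [worklist_setReg] using hs''
  · rintro s' ⟨hexp', hok'⟩
    rw [hok', hY.eq_thueMorseAffine_iff hp]
    exact forall_congr' fun w => forall_prop_of_true (hexp'.mem_processed hm.pos hsize.ge w)

theorem spec_explore (hp : 1 ≤ p) (hW : WordSize (2 ^ p) N W) (hm : ModulusSize (2 ^ p) N W m)
    (hr : r < m) (hs : Prepared A F m r s) (hseen : ∀ v, s.arr .seen v ≠ 1) {Y : Set ℕ}
    (hY : RecognizesWith A F Y) :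
    Spec W (loopBound (2 ^ p) p N) explore s (·.reg .ok = 1 ↔ Y = thueMorseAffine m r) := by
  refine spec_seq.2 ((spec_initExploration hm hs hseen).mono fun s' hs' ⟨hsize, hok, hexp⟩ => ?_)
  exact spec_exploreRounds hp hW hm hr (hs.of_agreeOff hs') hsize hexp hok hY

theorem spec_checkCandidate (hp : 1 ≤ p) (hW : WordSize (2 ^ p) N W)
    (hm : 3 * m ≤ 4 * (2 ^ p * N)) (hs : Prepared A F m r s) (hseen : ∀ v, s.arr .seen v ≠ 1)
    {Y : Set ℕ} (hY : RecognizesWith A F Y) :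
    Spec W (loopBound (2 ^ p) p N) checkCandidate s
      (·.reg .ok = 1 ↔ r < m ∧ Y = thueMorseAffine m r) := by
  simp only [checkCandidate, spec_ite, Comparison.Holds, ArithExpr.ok_var, ArithExpr.eval_var,
    hs.modulus, hs.remainder, true_and]
  refine ⟨fun hr => ?_, fun hr => ?_⟩
  · exact (spec_explore hp hW (hW.modulusSize (by omega) hm) hr hs hseen hY).mono fun _ _ hs' =>
      hs'.trans (and_iff_right hr).symm
  · simp [spec_assign, hr]

end

/-! ### The decision procedure -/

/-- Computes the base and strips common last digits from the recognized set. -/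
def reduceInput : Cmd Var Arr := computeBase ;; markReachable ;; stripDigits

/-- Decides in `ok` whether the recognized set has the form `m T + r`. -/
def decideAffine : Cmd Var Arr := reduceInput ;; findCandidate ;; computeBits ;; checkCandidate

/-- Decides whether the recognized set has the form `m T + r` and returns the answer in `N`. -/
def answerAffine : Cmd Var Arr :=
  decideAffine ;; .ite .eq (.var .ok) (.lit 1) (.assign .N (.lit 1)) (.assign .N (.lit 0))

/-- The variables and arrays in the order of their declaration, followed by the scratch
registers. The order agrees with `RAM.inputStore`. -/
def layout : Layout Var Arr where
  reg := Var.ctorIdx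
  arr := Arr.ctorIdx
  reg_injective x y h := by rw [← Var.ofNat_ctorIdx x, h, Var.ofNat_ctorIdx]
  arr_injective a c h := by rw [← Arr.ofNat_ctorIdx a, h, Arr.ofNat_ctorIdx]
  scratch := 25
  reg_lt_scratch x := by cases x <;> decide

/-- The initial values of the variables and arrays. -/
noncomputable def initialState {p N : ℕ} (A : DFA (Fin (2 ^ p)) (Fin N)) : State Var Arr where
  reg x := (RAM.inputStore p N A).reg (layout.reg x)
  arr a := (RAM.inputStore p N A).arr (layout.arr a)

section

variable {p N W : ℕ} {A : DFA (Fin (2 ^ p)) (Fin N)}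

theorem represents_initialState : layout.Represents (RAM.inputStore p N A) (initialState A) :=
  ⟨fun _ => rfl, fun _ => rfl⟩

theorem bounded_initialState (hW : WordSize (2 ^ p) N W) : (initialState A).Bounded W := by
  have hN := hW.four_mul_card_le
  have hp : p < 2 ^ p := Nat.lt_two_pow_self
  have hb := hW.four_mul_base_le
  have hstart := A.start.2
  constructor
  · intro x
    simp only [initialState, RAM.inputStore]
    split_ifs <;> omega
  · intro a j
    simp only [initialState, RAM.inputStore]
    split_ifs <;> omega

theorem initialState_delta (q : Fin N) (d : Fin (2 ^ p)) :
    (initialState A).arr .delta (q * 2 ^ p + d) = A.step q d := by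
  have hlt := mul_add_lt_mul q.2 d.2
  have hdiv : (q * 2 ^ p + d : ℕ) / 2 ^ p = q := mul_add_div_of_lt d.2
  have hmod : (q * 2 ^ p + d : ℕ) % 2 ^ p = d := Nat.mul_add_mod_of_lt d.2
  simp only [initialState, RAM.inputStore, layout, Arr.ctorIdx, dif_pos hlt, hdiv, hmod]
  rfl

theorem marked_acc_initialState : marked (initialState A) .acc N = A.accept := by
  ext q
  simp [marked, initialState, RAM.inputStore, layout, Arr.ctorIdx]

theorem initialState_arr_eq_zero {a : Arr} (ha : a ≠ .delta ∧ a ≠ .acc) (j : ℕ) :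
    (initialState A).arr a j = 0 := by
  cases a <;> simp_all [initialState, RAM.inputStore, layout, Arr.ctorIdx]

theorem loaded_of_agreeOff_computeBase {s : State Var Arr}
    (hs : computeBase.AgreeOff (initialState A) s) (hbase : s.reg .base = 2 ^ p) : Loaded A s where
  card := hs.reg .N (by decide)
  base := hbase
  start := hs.reg .start (by decide)
  delta q d := (congrFun (hs.arr .delta (by decide)) _).trans (initialState_delta q d)

theorem marked_of_agreeOff {P : Cmd Var Arr} {s s' : State Var Arr} {a : Arr}
    (hs : P.AgreeOff s s') (ha : a ∉ P.arrs := by decide) : marked s' a N = marked s a N := by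
  rw [marked, marked, hs.arr a ha]

theorem spec_reduceInput (hW : WordSize (2 ^ p) N W) {Y : Set ℕ} (hY : RecognizesSet A Y) :
    Spec W (loopBound (2 ^ p) p N) reduceInput (initialState A) fun s' =>
      Loaded A s' ∧ RecognizesWith A (marked s' .acc N) ((stripDigit (2 ^ p))^[N] Y) := by
  have hle := hW.four_mul_base_le
  refine spec_seq.2 ((spec_computeBase (s := initialState A) (p := p) (by omega) rfl).mono
    fun s₁ hs₁ hbase => ?_)
  have hA₁ := loaded_of_agreeOff_computeBase hs₁ hbase
  have hreach : marked s₁ .reach N = ∅ := by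
    simp [marked, hs₁.arr .reach (by decide), initialState_arr_eq_zero]
  refine spec_seq.2 ((spec_markReachable hW hA₁ hreach).mono fun s₂ hs₂ hreach₂ => ?_)
  have hA₂ := hA₁.of_agreeOff hs₂
  have hY₂ : RecognizesWith A (marked s₂ .acc N) Y := by
    rw [marked_of_agreeOff hs₂, marked_of_agreeOff hs₁, marked_acc_initialState]
    exact hY.recognizesWith
  exact (spec_stripDigits hW hA₂ hreach₂ hY₂).mono fun s₃ hs₃ hY₃ => ⟨hA₂.of_agreeOff hs₃, hY₃⟩

theorem isThueMorseAffine_iff_of_candidate (hp : 1 ≤ p) {F : Set (Fin N)} {Y : Set ℕ}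
    (hY : RecognizesSet A Y) (hF : RecognizesWith A F ((stripDigit (2 ^ p))^[N] Y)) {m r : ℕ}
    (hcand : ∀ m' r', r' < m' → m' ≤ 2 ^ p * N →
      (stripDigit (2 ^ p))^[N] Y = thueMorseAffine m' r' → m = m' ∧ r = r') :
    (r < m ∧ (stripDigit (2 ^ p))^[N] Y = thueMorseAffine m r) ↔ IsThueMorseAffine Y := by
  have hb : 1 < 2 ^ p := Nat.one_lt_two_pow (by omega)
  have hb3 : (2 ^ p).Coprime 3 := Nat.Coprime.pow_left p (by decide)
  constructor
  · rintro ⟨hr, heq⟩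
    exact (isThueMorseAffine_iterate_stripDigit_iff (by omega) hb3 N).1 ⟨m, r, hr, heq⟩
  · intro h
    obtain ⟨m', r', hr', hm', heq⟩ :=
      exists_iterate_stripDigit_eq_thueMorseAffine hb hb3 hY.recognizesWith h
    rw [Fintype.card_fin] at heq
    have hle := le_two_pow_mul_card hr' hm' (heq ▸ hF)
    rw [Fintype.card_fin] at hle
    obtain ⟨rfl, rfl⟩ := hcand m' r' hr' hle heq
    exact ⟨hr', heq⟩

theorem spec_decideAffine (hp : 1 ≤ p) (hW : WordSize (2 ^ p) N W) {Y : Set ℕ}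
    (hY : RecognizesSet A Y) :
    Spec W (loopBound (2 ^ p) p N) decideAffine (initialState A)
      (·.reg .ok = 1 ↔ IsThueMorseAffine Y) := by
  refine spec_seq.2 ((spec_reduceInput hW hY).mono fun s₁ hs₁ ⟨hA₁, hY₁⟩ => ?_)
  refine spec_seq.2 ((spec_findCandidate hW hA₁ hY₁).mono fun s₂ hs₂ ⟨hm, hcand⟩ => ?_)
  have hzero (a : Arr) (j : ℕ) (ha : a ≠ .delta ∧ a ≠ .acc := by decide)
      (hnorm : a ∉ reduceInput.arrs := by decide) (hfind : a ∉ findCandidate.arrs := by decide) :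
      s₂.arr a j = 0 := by
    rw [hs₂.arr a hfind, hs₁.arr a hnorm, initialState_arr_eq_zero ha]
  have hA₂ := hA₁.of_agreeOff hs₂
  refine spec_seq.2 ((spec_computeBits hW hA₂ (hzero .bits 0)).mono fun s₃ hs₃ hbits => ?_)
  have hprep : Prepared A (marked s₁ .acc N) (s₂.reg .m) (s₂.reg .r) s₃ :=
    { toLoaded := hA₂.of_agreeOff hs₃
      modulus := hs₃.reg .m (by decide)
      remainder := hs₃.reg .r (by decide)
      bits := hbits
      acc := by rw [marked_of_agreeOff hs₃, marked_of_agreeOff hs₂] }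
  have hseen (v : ℕ) : s₃.arr .seen v ≠ 1 := by simp [hs₃.arr .seen (by decide), hzero .seen v]
  exact (spec_checkCandidate hp hW hm hprep hseen hY₁).mono fun _ _ hok =>
    hok.trans (isThueMorseAffine_iff_of_candidate hp hY hY₁ hcand)

open Classical in
theorem spec_answerAffine (hp : 1 ≤ p) (hW : WordSize (2 ^ p) N W) {Y : Set ℕ}
    (hY : RecognizesSet A Y) :
    Spec W (loopBound (2 ^ p) p N) answerAffine (initialState A)
      (·.reg .N = if IsThueMorseAffine Y then 1 else 0) := by
  have hone : 1 ≤ W := by have := hW.four_mul_base_le; have := hW.two_le; omega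
  refine spec_seq.2 ((spec_decideAffine hp hW hY).mono fun s _ hok => ?_)
  by_cases hok' : s.reg .ok = 1 <;>
    simp [spec_ite, spec_assign, hok', ← hok, hone, Comparison.Holds]

theorem cost_answerAffine_le (hN : 1 ≤ N) :
    answerAffine.cost (loopBound (2 ^ p) p N) ≤ 1100 * ((2 ^ p) ^ 2 * N ^ 2) := by
  have hp : p < 2 ^ p := Nat.lt_two_pow_self
  simp only [answerAffine, decideAffine, reduceInput, computeBase, markReachable, markRound,
    markSuccessors, stripDigits, findDigit, testDigit, shiftAccept, findCandidate, tabulateRuns,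
    findLeastTwo, computeBits, checkCandidate, explore, initExploration, exploreRound,
    processVertex, appendSuccessors, computeSuccessor, testVertex, decodeVertex, enqueueNext,
    transition, Cmd.when, Cmd.tabulate, Cmd.cost, ArithExpr.cost_var,
    ArithExpr.cost_lit, ArithExpr.cost_add, ArithExpr.cost_sub, ArithExpr.cost_mul,
    ArithExpr.cost_div, ArithExpr.cost_mod, ArithExpr.cost_get, loopBound]
  generalize 2 ^ p = b at *
  have hb : 1 ≤ b := by omega
  have hmono {x y : ℕ} (hx : x ≤ b ^ 2) (hy : y ≤ N ^ 2) : x * y ≤ b ^ 2 * N ^ 2 :=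
    Nat.mul_le_mul hx hy
  have hb_one : 1 ≤ b ^ 2 := Nat.one_le_pow _ _ hb
  have hb_self : b ≤ b ^ 2 := Nat.le_self_pow two_ne_zero _
  have hN_one : 1 ≤ N ^ 2 := Nat.one_le_pow _ _ hN
  have hN_self : N ≤ N ^ 2 := Nat.le_self_pow two_ne_zero _
  have hone := hmono hb_one hN_one
  have hbase := hmono hb_self hN_one
  have hcard := hmono hb_one hN_self
  have hbase_card := hmono hb_self hN_self
  have hcard_sq := hmono hb_one le_rfl
  have hbase_card_sq := hmono hb_self le_rfl
  ring_nf at *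
  omega

end

open Classical in
theorem mainTheorem5 :
    ∃ P : RAM.Program, ∀ p : ℕ, 1 ≤ p → ∃ C : ℕ,
      ∀ (N : ℕ) (A : DFA (Fin (2 ^ p)) (Fin N)) (Y : Set ℕ), RecognizesSet A Y →
        ∃ (t : ℕ) (s : RAM.Store),
          RAM.Exec (C * N ^ 2) P (RAM.inputStore p N A) t s ∧
          t ≤ C * N ^ 2 ∧
          s.reg 0 = (if ∃ m r : ℕ, r < m ∧ Y = thueMorseAffine m r then 1 else 0) := by
  refine ⟨answerAffine.compile layout, fun p hp => ⟨1100 * (2 ^ p) ^ 2, fun N A Y hY => ?_⟩⟩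
  have hN : 1 ≤ N := A.start.pos
  have hW : WordSize (2 ^ p) N (1100 * (2 ^ p) ^ 2 * N ^ 2) :=
    ⟨Nat.le_self_pow (by omega) 2, hN, by rw [mul_assoc]; gcongr; norm_num⟩
  have hcost := cost_answerAffine_le (p := p) hN
  rw [← mul_assoc] at hcost
  obtain ⟨hok, hanswer⟩ := spec_answerAffine hp hW hY
  have hWpos : 0 < 1100 * (2 ^ p) ^ 2 * N ^ 2 := by positivity
  obtain ⟨t, ht, s, hexec, hs⟩ := answerAffine.haltsWithin_compile hWpos (bounded_initialState hW)
    hok represents_initialState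
  exact ⟨t, s, hexec, ht.trans hcost, (hs.reg .N).trans hanswer⟩
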